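/- Let $\alpha\in\mathbb R$ and $\beta>-1$. A meromorphic function $f$ in $\mathbb C$ belongs to the class $Y_{\alpha,\beta}$ (generalised Yosida functions) if it is transcendental (not rational), the family $(f_h)_{|h|\ge 1}$ of functions $f_h(z)=h^{-\alpha}f(h+h^{-\beta}z)$ (with the principal determination of $h^{-\alpha}$ and $h^{-\beta}$; any other determination gives the same class) is normal in $\mathbb C$ with respect to the spherical metric, and no limit function $\lim_{n\to\infty}f_{h_n}$ with $h_n\to\infty$ (locally uniform limit with respect to the spherical metric) is constant, where $\infty$ counts as a constant. Theorem. Let $f\in Y_{\alpha,\beta}$ with $\beta>-1$, suppose that $f(0)\ne 0,\infty$, and let $m$ be any integer with $m>\beta$ (so $m\ge 0$). Let $\mathcal Q$ and $\mathcal P$ be the sets of zeros and of poles of $f$, and let $T_{m-1}$ be the $(m-1)$-th Taylor polynomial of $f'/f$ at $0$ ($T_{-1}=0$). Then $$\frac{f'(z)}{f(z)}=T_{m-1}(z)+\lim_{r\to\infty}\Big[\sum_{q\in\mathcal Q,\,|q|<r}\frac{z^m}{(z-q)q^m}-\sum_{p\in\mathcal P,\,|p|<r}\frac{z^m}{(z-p)p^m}\Big]$$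 holds locally uniformly in $\mathbb C\setminus(\mathcal P\cup\mathcal Q)$, where $r\to\infty$ through the positive real numbers and each zero $q$ and each pole $p$ occurs in the sums according to its multiplicity. -/

import Mathlib

open Set Filter Topology Polynomial

namespace Yosida

noncomputable section

/-- The chordal metric of the Riemann sphere `ℂ ∪ {∞}`. -/
def chordal : OnePoint ℂ → OnePoint ℂ → ℝ
  | OnePoint.infty, OnePoint.infty => 0
  | OnePoint.infty, OnePoint.some w => 2 / √(1 + ‖w‖ ^ 2)
  | OnePoint.some z, OnePoint.infty => 2 / √(1 + ‖z‖ ^ 2)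
  | OnePoint.some z, OnePoint.some w => 2 * ‖z - w‖ / (√(1 + ‖z‖ ^ 2) * √(1 + ‖w‖ ^ 2))

/-- Locally uniform convergence on `ℂ` of a sequence of maps into the Riemann sphere, with respect
to the chordal (equivalently, the spherical) metric. -/
def SphericalTendsto (F : ℕ → ℂ → OnePoint ℂ) (φ : ℂ → OnePoint ℂ) : Prop :=
  ∀ K : Set ℂ, IsCompact K → ∀ ε : ℝ, 0 < ε →
    ∃ N : ℕ, ∀ n : ℕ, N ≤ n → ∀ z ∈ K, chordal (F n z) (φ z) < ε

/-- The value in the Riemann sphere of a meromorphic function in normal form: Mathlib stores the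
junk value `0` at a pole, here it is replaced by `∞`. -/
def value (f : ℂ → ℂ) (z : ℂ) : OnePoint ℂ :=
  open Classical in
  if meromorphicOrderAt f z < 0 then OnePoint.infty else ((f z : ℂ) : OnePoint ℂ)

/-- The function `f_h(z) = h^{-α} f(h + h^{-β} z)`, with values in the Riemann sphere (where
`h^{-α} · ∞ = ∞`) and with the principal determination of the powers. -/
def rescale (f : ℂ → ℂ) (α β : ℝ) (h z : ℂ) : OnePoint ℂ :=
  OnePoint.map (fun w : ℂ => h ^ (-(α : ℂ)) * w) (value f (h + h ^ (-(β : ℂ)) * z))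

/-- `f` is a rational function. -/
def IsRational (f : ℂ → ℂ) : Prop :=
  ∃ P Q : ℂ[X], Q ≠ 0 ∧ ∀ z : ℂ, Q.eval z ≠ 0 → f z = P.eval z / Q.eval z

/-- The class of generalised Yosida functions with parameters `α ∈ ℝ` and `β > -1`. -/
structure GeneralisedYosida (α β : ℝ) (f : ℂ → ℂ) : Prop where
  /-- `f` is meromorphic in the plane, with its canonical values at removable singularities. -/
  meromorphic : MeromorphicNFOn f univ
  transcendental : ¬ IsRational f
  /-- `(f_h)_{|h| ≥ 1}` is a normal family in `ℂ`. -/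
  normal : ∀ h : ℕ → ℂ, (∀ n, 1 ≤ ‖h n‖) →
    ∃ σ : ℕ → ℕ, StrictMono σ ∧ ∃ φ : ℂ → OnePoint ℂ,
      SphericalTendsto (fun n => rescale f α β (h (σ n))) φ
  /-- No limit function for `h_n → ∞` is constant (finite or `∞`). -/
  nonconstant : ∀ (h : ℕ → ℂ) (φ : ℂ → OnePoint ℂ), (∀ n, 1 ≤ ‖h n‖) →
    Tendsto (fun n => ‖h n‖) atTop atTop →
    SphericalTendsto (fun n => rescale f α β (h n)) φ → ¬ ∃ c : OnePoint ℂ, ∀ z : ℂ, φ z = c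

/-- Multiplicity of `z` as a zero of `f` (`0` if `z` is not a zero). -/
def zeroMult (f : ℂ → ℂ) (z : ℂ) : ℕ := (meromorphicOrderAt f z).untop₀.toNat

/-- Multiplicity of `z` as a pole of `f` (`0` if `z` is not a pole). -/
def poleMult (f : ℂ → ℂ) (z : ℂ) : ℕ := (-(meromorphicOrderAt f z).untop₀).toNat

/-- `∑_{|q| < r} z^m / ((z - q) q^m) - ∑_{|p| < r} z^m / ((z - p) p^m)`, over the zeros `q` and
the poles `p` of `f`, counted with multiplicity. -/
def bracket (f : ℂ → ℂ) (m : ℕ) (r : ℝ) (z : ℂ) : ℂ :=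
  (∑ᶠ (q : ℂ) (_ : ‖q‖ < r), (zeroMult f q : ℂ) * (z ^ m / ((z - q) * q ^ m))) -
    ∑ᶠ (p : ℂ) (_ : ‖p‖ < r), (poleMult f p : ℂ) * (z ^ m / ((z - p) * p ^ m))

/-- The sum of the first `m` terms of the Taylor series of `g` at `0`, that is, the `(m-1)`-th
Taylor polynomial (which is `0` if `m = 0`). -/
def taylorSum (g : ℂ → ℂ) (m : ℕ) (z : ℂ) : ℂ :=
  ∑ j ∈ Finset.range m, iteratedDeriv j g 0 / (j.factorial : ℂ) * z ^ j

end

end Yosida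

open Set Filter Topology Polynomial

namespace Yosida

noncomputable section

/-! The proof is Cauchy's residue method with the kernel z^m / (ζ^m (ζ - z)). On a circle |ζ| = t
free of zeros and poles, the integral of f'/f against this kernel is, up to the factor 2πi, exactly
the remainder of the expansion truncated at |a| < t (`remainder_eq_circleIntegral`). On |z| ≤ R the
kernel is O(t^(-m-1)), so the theorem follows once the integral of |f'/f| over suitable circles is
O(t^(1+β) log t), because m > β.

That growth comes from normality. If a rescaled function is close to a nonconstant limit near the
origin, then it, or its reciprocal, is bounded above on a disc and below on a smaller circle. This
bounds the number of its zeros and poles near 0, and bounds its logarithmic derivative by a constant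
plus ∑ 1/|a| over them (`zeros_and_logDeriv_bound`). A compactness argument makes the constants
uniform; undoing the scaling gives, for all large |h|, boundedly many zeros and poles in a disc of
radius comparable to |h|^(-β) about h, and |f'/f|(h) ≤ O(|h|^β) + ∑ |ord a| / |a - h| over nearby a
(`GeneralisedYosida.exists_scaleControl`).

Covering an annulus of width about t^(-β) by such discs shows that it contains O(t^(1+β)) zeros and
poles. Hence a radius t just above r keeps a distance δ from all their moduli, where t/δ is bounded
by a power of r. Each term 1/|a - ζ| then integrates over the angle to O(t^(-1) log(1 + t/δ)), so
the mean of |f'/f| over the circle is O(t^β log t). Passing from t back to r changes the bracket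
only by the terms of one thin annulus, which is O(r^(β-m)). -/

/-- The order of `f` at `a` as an integer (`0` if `f` vanishes identically near `a`). -/
def ord (f : ℂ → ℂ) (a : ℂ) : ℤ := (meromorphicOrderAt f a).untop₀

/-! ### Factorisation on discs, orders, and affine rescaling. -/

lemma exists_factorization {f : ℂ → ℂ} (hf : MeromorphicNFOn f univ)
    (hord : ∀ a, meromorphicOrderAt f a ≠ ⊤) (c : ℂ) (R : ℝ) :
    ∃ (Z : Finset ℂ) (g : ℂ → ℂ), (∀ a, a ∈ Z ↔ a ∈ Metric.closedBall c R ∧ ord f a ≠ 0) ∧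
      AnalyticOnNhd ℂ g (Metric.closedBall c R) ∧ (∀ z ∈ Metric.closedBall c R, g z ≠ 0) ∧
      ∀ z ∈ Metric.ball c R, f =ᶠ[𝓝 z] fun w => (∏ a ∈ Z, (w - a) ^ ord f a) * g w := by
  have hm : MeromorphicOn f (Metric.closedBall c R) :=
    fun z _ => (hf (mem_univ z)).meromorphicAt
  have hfin := (MeromorphicOn.divisor f (Metric.closedBall c R)).finiteSupport
    (isCompact_closedBall c R)
  obtain ⟨g, hg, hg0, hfg⟩ := hm.extract_zeros_poles (fun u => hord u) hfin
  have hD : ∀ a ∈ Metric.closedBall c R,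
      MeromorphicOn.divisor f (Metric.closedBall c R) a = ord f a := fun a ha => by
    rw [MeromorphicOn.divisor_apply hm ha, ord]
  refine ⟨hfin.toFinset, g, fun a => ?_, hg, fun z hz => hg0 ⟨z, hz⟩, fun z hz => ?_⟩
  · rw [Set.Finite.mem_toFinset, Function.mem_support]
    by_cases ha : a ∈ Metric.closedBall c R
    · simp [hD a ha, ha]
    · simp [ha]
  · have hprod : (∏ᶠ u, (fun w : ℂ => w - u) ^
        MeromorphicOn.divisor f (Metric.closedBall c R) u) =
        fun w => ∏ a ∈ hfin.toFinset, (w - a) ^ ord f a := by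
      rw [finprod_eq_prod_of_mulSupport_subset (s := hfin.toFinset) _
        (by rw [Function.FactorizedRational.mulSupport]; simp)]
      ext w
      rw [Finset.prod_apply]
      refine Finset.prod_congr rfl fun a ha => ?_
      rw [Set.Finite.mem_toFinset] at ha
      rw [Pi.pow_apply, hD a]
      by_contra h
      exact ha (by simp [h])
    have hz' := Metric.ball_subset_closedBall hz
    have hnf : MeromorphicNFAt (fun w => (∏ a ∈ hfin.toFinset, (w - a) ^ ord f a) * g w) z := by
      have := (Function.FactorizedRational.meromorphicNFOn
        (MeromorphicOn.divisor f (Metric.closedBall c R)) (Metric.closedBall c R)) hz'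
      rw [hprod] at this
      exact (meromorphicNFAt_mul_iff_left (hg z hz') (hg0 ⟨z, hz'⟩)).2 this
    -- Both sides are in normal form, so agreement off the point extends to the point, including the
    -- value 0 stored at a pole.
    rw [← (hf (mem_univ z)).eventuallyEq_nhdsNE_iff_eventuallyEq_nhds hnf]
    rw [hprod] at hfg
    have h1 := hfg.filter_mono (codiscreteWithin_mono Metric.ball_subset_closedBall)
    have h2 := mem_codiscreteWithin_iff_forall_mem_nhdsNE.1 h1 z hz
    filter_upwards [h2, mem_nhdsWithin_of_mem_nhds (Metric.isOpen_ball.mem_nhds hz)] with w hw hw2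
    rcases hw with hw | hw
    · exact hw
    · exact absurd hw2 hw

lemma logDeriv_prod_mul {Z : Finset ℂ} {n : ℂ → ℤ} {g : ℂ → ℂ} {z : ℂ} (hz : ∀ a ∈ Z, z ≠ a)
    (hg : DifferentiableAt ℂ g z) (hg0 : g z ≠ 0) :
    logDeriv (fun w => (∏ a ∈ Z, (w - a) ^ n a) * g w) z =
      ∑ a ∈ Z, (n a : ℂ) / (z - a) + logDeriv g z := by
  have hd : ∀ a ∈ Z, DifferentiableAt ℂ (fun w : ℂ => (w - a) ^ n a) z := fun a ha =>
    DifferentiableAt.zpow (by fun_prop) (Or.inl (sub_ne_zero.2 (hz a ha)))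
  have h0 : ∀ a ∈ Z, (z - a) ^ n a ≠ 0 := fun a ha => zpow_ne_zero _ (sub_ne_zero.2 (hz a ha))
  rw [logDeriv_mul z (Finset.prod_ne_zero_iff.2 h0) hg0 (DifferentiableAt.fun_finsetProd hd) hg]
  congr 1
  rw [logDeriv_prod (f := fun a w => (w - a) ^ n a) h0 hd]
  refine Finset.sum_congr rfl fun a _ => ?_
  rw [logDeriv_fun_zpow (by fun_prop), logDeriv_apply]
  simp [div_eq_mul_inv]

lemma ord_inv (f : ℂ → ℂ) (z : ℂ) : ord f⁻¹ z = - ord f z := by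
  rw [ord, ord, meromorphicOrderAt_inv]
  simp

lemma meromorphicOrderAt_rescale {f : ℂ → ℂ} {c l : ℂ} (h : ℂ) (hc : c ≠ 0) (hl : l ≠ 0) (a : ℂ) :
    meromorphicOrderAt (fun z => c * f (h + l * z)) a = meromorphicOrderAt f (h + l * a) := by
  have h1 : meromorphicOrderAt (fun z => f (h + l * z)) a = meromorphicOrderAt f (h + l * a) :=
    meromorphicOrderAt_comp_of_deriv_ne_zero (g := fun z => h + l * z) (f := f) (by fun_prop)
      (by simp [deriv_const_add, hl])
  rw [← h1]
  exact meromorphicOrderAt_mul_of_ne_zero (g := fun _ => c) analyticAt_const hc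

lemma meromorphicNFOn_rescale {f : ℂ → ℂ} (hf : MeromorphicNFOn f univ)
    {c l : ℂ} (h : ℂ) (hc : c ≠ 0)
    (hl : l ≠ 0) : MeromorphicNFOn (fun z => c * f (h + l * z)) univ := fun a _ => by
  have h1 : MeromorphicNFAt (f ∘ fun z => h + l * z) a :=
    (meromorphicNFAt_comp_iff_of_deriv_ne_zero (by fun_prop)
      (by simp [deriv_const_add, hl])).2 (hf (mem_univ _))
  exact (meromorphicNFAt_mul_iff_right (g := fun _ => c) analyticAt_const hc).2 h1

lemma norm_prod_pow_le {Z : Finset ℂ} {n : ℂ → ℕ} {s : ℝ} (hZ : ∀ a ∈ Z, ‖a‖ < s) {w : ℂ}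
    (hw : ‖w‖ ≤ s) : ‖∏ a ∈ Z, (w - a) ^ n a‖ ≤ (2 * s) ^ ∑ a ∈ Z, n a := by
  rw [norm_prod, ← Finset.prod_pow_eq_pow_sum]
  refine Finset.prod_le_prod (fun _ _ => norm_nonneg _) fun a ha => ?_
  rw [norm_pow]
  gcongr
  linarith [norm_sub_le w a, hZ a ha]

lemma le_norm_prod_pow {Z : Finset ℂ} {n : ℂ → ℕ} {s : ℝ} (hs : 0 < s) (hZ : ∀ a ∈ Z, ‖a‖ < s)
    {w : ℂ} (hw : ‖w‖ = 5 * s) : (4 * s) ^ ∑ a ∈ Z, n a ≤ ‖∏ a ∈ Z, (w - a) ^ n a‖ := by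
  rw [norm_prod, ← Finset.prod_pow_eq_pow_sum]
  refine Finset.prod_le_prod (fun _ _ => by positivity) fun a ha => ?_
  rw [norm_pow]
  gcongr
  linarith [norm_sub_norm_le w a, hZ a ha]

lemma coe_ord {f : ℂ → ℂ} (hord : ∀ a, meromorphicOrderAt f a ≠ ⊤) (a : ℂ) :
    ((ord f a : ℤ) : WithTop ℤ) = meromorphicOrderAt f a := WithTop.coe_untop₀_of_ne_top (hord a)

lemma ord_eq_zero_of_ne_zero {f : ℂ → ℂ} (hf : MeromorphicNFOn f univ) {a : ℂ} (h : f a ≠ 0) :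
    ord f a = 0 := by
  rw [ord, (hf (mem_univ a)).meromorphicOrderAt_eq_zero_iff.2 h]; rfl

lemma ne_zero_of_ord_eq_zero {f : ℂ → ℂ} (hf : MeromorphicNFOn f univ)
    (hord : ∀ a, meromorphicOrderAt f a ≠ ⊤) {a : ℂ} (h : ord f a = 0) : f a ≠ 0 := by
  rw [← (hf (mem_univ a)).meromorphicOrderAt_eq_zero_iff, ← coe_ord hord, h]; rfl

/-! ### Counting zeros from an upper and a lower bound. -/

/-- A function that is bounded above on a disc and below on a much smaller circle has few zeros
near the centre, and its logarithmic derivative is governed by these zeros. -/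
lemma zeros_and_logDeriv_bound {F : ℂ → ℂ} (hF : MeromorphicNFOn F univ)
    (hord : ∀ a, meromorphicOrderAt F a ≠ ⊤) {s B η : ℝ} (hs : 0 < s) (hη : 0 < η)
    (hpos : ∀ z ∈ Metric.closedBall (0 : ℂ) (6 * s), 0 ≤ ord F z)
    (hB : ∀ z ∈ Metric.closedBall (0 : ℂ) (6 * s), ‖F z‖ ≤ B)
    (hlow : ∀ z ∈ Metric.sphere (0 : ℂ) s, η ≤ ‖F z‖) :
    ∃ Z : Finset ℂ, (∀ a, a ∈ Z ↔ ‖a‖ < s ∧ ord F a ≠ 0) ∧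
      ∑ a ∈ Z, |(ord F a : ℝ)| ≤ B / η ∧
      (ord F 0 = 0 → ‖logDeriv F 0‖ ≤ B / (η * s) + ∑ a ∈ Z, |(ord F a : ℝ)| / ‖a‖) := by
  classical
  obtain ⟨Z₀, g, hZ₀, hg, hg0, hfac⟩ := exists_factorization hF hord 0 (6 * s)
  -- Only the zeros in |a| < s are divided out. The others stay in the cofactor `H`, which is
  -- therefore zero-free on |w| ≤ s: the lower bound excludes zeros on the circle itself.
  set Z := Z₀.filter (‖·‖ < s) with hZdef
  set Y := Z₀.filter (¬ ‖·‖ < s) with hYdef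
  set n : ℂ → ℕ := fun a => (ord F a).toNat with hn
  have hnat : ∀ a ∈ Z₀, ord F a = (n a : ℤ) := fun a ha =>
    (Int.toNat_of_nonneg (hpos a ((hZ₀ a).1 ha).1)).symm
  have hZs : ∀ a ∈ Z, ‖a‖ < s := fun a ha => (Finset.mem_filter.1 ha).2
  have hZZ : ∀ a ∈ Z, a ∈ Z₀ := fun a ha => (Finset.mem_filter.1 ha).1
  have hYZ : ∀ a ∈ Y, a ∈ Z₀ := fun a ha => (Finset.mem_filter.1 ha).1
  have hsphere : ∀ z ∈ Metric.sphere (0 : ℂ) s, F z ≠ 0 := fun z hz h => by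
    have := hlow z hz; rw [h, norm_zero] at this; linarith
  have hYs : ∀ a ∈ Y, s < ‖a‖ := fun a ha => by
    have h1 := (Finset.mem_filter.1 ha).2
    refine lt_of_le_of_ne (not_lt.1 h1) fun h => ?_
    exact ((hZ₀ a).1 (hYZ a ha)).2 (ord_eq_zero_of_ne_zero hF (hsphere a (by simp [h])))
  set H : ℂ → ℂ := fun w => (∏ a ∈ Y, (w - a) ^ n a) * g w with hH
  set P : ℂ → ℂ := fun w => ∏ a ∈ Z, (w - a) ^ n a with hP
  set k := ∑ a ∈ Z, n a with hk
  have hfacN : ∀ w, (∏ a ∈ Z₀, (w - a) ^ ord F a) * g w = P w * H w := fun w => by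
    rw [hP, hH, ← mul_assoc, ← Finset.prod_filter_mul_prod_filter_not Z₀ (‖·‖ < s)]
    congr 2
    · exact Finset.prod_congr rfl fun a ha => by rw [hnat a (hZZ a ha), zpow_natCast]
    · exact Finset.prod_congr rfl fun a ha => by rw [hnat a (hYZ a ha), zpow_natCast]
  have hFPH : ∀ w ∈ Metric.ball (0 : ℂ) (6 * s), F =ᶠ[𝓝 w] fun w => P w * H w := fun w hw => by
    filter_upwards [hfac w hw] with v hv
    rw [hv, hfacN]
  have hHd : DifferentiableOn ℂ H (Metric.closedBall 0 (6 * s)) :=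
    DifferentiableOn.mul (by fun_prop) hg.differentiableOn
  have hsub : ∀ r, r < 6 * s → Metric.closedBall (0 : ℂ) r ⊆ Metric.ball 0 (6 * s) :=
    fun r hr => Metric.closedBall_subset_ball hr
  have hH0 : ∀ w ∈ Metric.closedBall (0 : ℂ) s, H w ≠ 0 := fun w hw => by
    refine mul_ne_zero (Finset.prod_ne_zero_iff.2 fun a ha => pow_ne_zero _ (sub_ne_zero.2 ?_))
      (hg0 w (Metric.closedBall_subset_closedBall (by linarith) hw))
    rintro rfl
    have := hYs _ ha
    rw [mem_closedBall_zero_iff] at hw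
    linarith
  have hB0 : 0 ≤ B := (norm_nonneg _).trans (hB 0 (by simp [hs.le]))
  -- Maximum principle from the circle |w| = 5s, where each factor of `P` has modulus at least 4s.
  -- On |w| = s each factor is at most 2s; the quotient 2 per zero is what bounds their number.
  have hHle : ∀ w ∈ Metric.closedBall (0 : ℂ) (5 * s), ‖H w‖ ≤ B / (4 * s) ^ k := by
    intro w hw
    refine Complex.norm_le_of_forall_mem_frontier_norm_le (U := Metric.ball 0 (5 * s))
      Metric.isBounded_ball ?_ (fun z hz => ?_) (by rwa [closure_ball _ (by positivity)])
    · refine DifferentiableOn.diffContOnCl ?_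
      rw [closure_ball _ (by positivity)]
      exact hHd.mono (Metric.closedBall_subset_closedBall (by linarith))
    · rw [frontier_ball _ (by positivity), mem_sphere_zero_iff_norm] at hz
      have hz6 : z ∈ Metric.ball (0 : ℂ) (6 * s) := by rw [mem_ball_zero_iff]; linarith
      have h1 : F z = P z * H z := (hFPH z hz6).eq_of_nhds
      have h2 := hB z (Metric.ball_subset_closedBall hz6)
      rw [h1, norm_mul] at h2
      rw [le_div_iff₀ (by positivity), mul_comm]
      exact (mul_le_mul_of_nonneg_right (le_norm_prod_pow hs hZs hz) (norm_nonneg _)).trans h2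
  have hlowH : ∀ z ∈ Metric.sphere (0 : ℂ) s, η ≤ (2 * s) ^ k * ‖H z‖ := fun z hz => by
    have hz' := mem_sphere_zero_iff_norm.1 hz
    have hz6 : z ∈ Metric.ball (0 : ℂ) (6 * s) := by rw [mem_ball_zero_iff]; linarith
    have h1 : F z = P z * H z := (hFPH z hz6).eq_of_nhds
    have h2 := hlow z hz
    rw [h1, norm_mul] at h2
    exact h2.trans (mul_le_mul_of_nonneg_right (norm_prod_pow_le hZs hz'.le) (norm_nonneg _))
  have hpow : (4 * s) ^ k = 2 ^ k * (2 * s) ^ k := by rw [← mul_pow]; ring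
  have hinv : ∀ w ∈ Metric.closedBall (0 : ℂ) s, ‖(H w)⁻¹‖ ≤ (2 * s) ^ k / η := by
    intro w hw
    refine Complex.norm_le_of_forall_mem_frontier_norm_le (U := Metric.ball 0 s)
      (f := fun w => (H w)⁻¹)
      Metric.isBounded_ball ?_ (fun z hz => ?_) (by rwa [closure_ball _ hs.ne'])
    · refine DifferentiableOn.diffContOnCl ?_
      rw [closure_ball _ hs.ne']
      exact (hHd.mono (Metric.closedBall_subset_closedBall (by linarith))).inv hH0
    · rw [frontier_ball _ hs.ne'] at hz
      have := hlowH z hz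
      have hp : 0 < ‖H z‖ := norm_pos_iff.2 (hH0 z (Metric.sphere_subset_closedBall hz))
      rw [norm_inv, le_div_iff₀ hη, inv_mul_le_iff₀ hp, mul_comm]
      exact this
  have hs0 : ((s : ℝ) : ℂ) ∈ Metric.sphere (0 : ℂ) s := by simp [abs_of_pos hs]
  -- The two estimates for `H` are compared at the single point `s` of the small circle.
  have h2k : η * 2 ^ k ≤ B := by
    have h1 := hlowH _ hs0
    have h2 := hHle _ (Metric.closedBall_subset_closedBall (by linarith)
      (Metric.sphere_subset_closedBall hs0))
    rw [hpow] at h2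
    have h3 : (2 * s) ^ k * ‖H s‖ ≤ B / 2 ^ k := by
      rw [le_div_iff₀ (by positivity)] at h2 ⊢
      linarith
    rw [← le_div_iff₀ (by positivity)]
    exact h1.trans h3
  have habs : ∀ a ∈ Z, |(ord F a : ℝ)| = n a := fun a ha => by
    rw [hnat a (hZZ a ha)]; simp
  refine ⟨Z, fun a => ?_, ?_, fun h0 => ?_⟩
  · rw [hZdef, Finset.mem_filter, hZ₀, mem_closedBall_zero_iff]
    constructor
    · rintro ⟨⟨-, h⟩, h'⟩; exact ⟨h', h⟩
    · rintro ⟨h', h⟩; exact ⟨⟨by linarith, h⟩, h'⟩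
  · rw [Finset.sum_congr rfl habs, le_div_iff₀ hη, ← Nat.cast_sum]
    have : ((k : ℕ) : ℝ) ≤ 2 ^ k := by exact_mod_cast (Nat.lt_two_pow_self).le
    nlinarith
  · have hz6 : (0 : ℂ) ∈ Metric.ball (0 : ℂ) (6 * s) := by simp [hs]
    have hZ0 : ∀ a ∈ Z, (0 : ℂ) ≠ a := by
      rintro a ha rfl
      exact ((hZ₀ 0).1 (hZZ 0 ha)).2 h0
    have hHd0 : DifferentiableAt ℂ H 0 := hHd.differentiableAt
      (Metric.closedBall_mem_nhds _ (by positivity))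
    have h00 : (0 : ℂ) ∈ Metric.closedBall (0 : ℂ) s := by simp [hs.le]
    have h1 : logDeriv F 0 = ∑ a ∈ Z, ((n a : ℤ) : ℂ) / (0 - a) + logDeriv H 0 := by
      rw [(logDeriv_congr_nhds (hFPH 0 hz6)).eq_of_nhds, ← logDeriv_prod_mul hZ0 hHd0 (hH0 0 h00)]
      simp only [zpow_natCast, hP]
    rw [h1, add_comm]
    refine (norm_add_le _ _).trans (add_le_add ?_ ?_)
    · have hder : ‖deriv H 0‖ ≤ B / (4 * s) ^ k / s := by
        refine Complex.norm_deriv_le_of_forall_mem_sphere_norm_le hs ?_ fun z hz => hHle z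
          (Metric.closedBall_subset_closedBall (by linarith) (Metric.sphere_subset_closedBall hz))
        refine DifferentiableOn.diffContOnCl ?_
        rw [closure_ball _ hs.ne']
        exact hHd.mono (Metric.closedBall_subset_closedBall (by linarith))
      rw [logDeriv_apply, div_eq_mul_inv, norm_mul]
      calc ‖deriv H 0‖ * ‖(H 0)⁻¹‖ ≤ (B / (4 * s) ^ k / s) * ((2 * s) ^ k / η) :=
            mul_le_mul hder (hinv 0 h00) (norm_nonneg _) (by positivity)
        _ = B / (η * s) / 2 ^ k := by rw [hpow]; field_simp
        _ ≤ B / (η * s) := div_le_self (by positivity) (one_le_pow₀ (by norm_num))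
    · refine (norm_sum_le _ _).trans (Finset.sum_le_sum fun a ha => ?_)
      rw [norm_div, habs a ha]
      simp

/-! ### The chordal metric and its invariance under inversion. -/

lemma chordal_comm (x y : OnePoint ℂ) : chordal x y = chordal y x := by
  induction x using OnePoint.rec <;> induction y using OnePoint.rec
  · rfl
  · rfl
  · rfl
  · simp only [chordal]
    rw [norm_sub_rev, mul_comm (√_)]

/-- The inversion `z ↦ 1 / z` of the Riemann sphere. -/
def sphereInv : OnePoint ℂ → OnePoint ℂ
  | OnePoint.infty => ((0 : ℂ) : OnePoint ℂ)
  | OnePoint.some z => open Classical in if z = 0 then OnePoint.infty else ((z⁻¹ : ℂ) : OnePoint ℂ)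

lemma sphereInv_infty : sphereInv OnePoint.infty = ((0 : ℂ) : OnePoint ℂ) := rfl

lemma sphereInv_zero : sphereInv ((0 : ℂ) : OnePoint ℂ) = OnePoint.infty := by
  simp [sphereInv]

lemma sphereInv_coe {z : ℂ} (hz : z ≠ 0) :
    sphereInv (z : OnePoint ℂ) = ((z⁻¹ : ℂ) : OnePoint ℂ) := by
  simp [sphereInv, hz]

lemma sphereInv_sphereInv (x : OnePoint ℂ) : sphereInv (sphereInv x) = x := by
  induction x using OnePoint.rec with
  | infty => rw [sphereInv_infty, sphereInv_zero]
  | coe z =>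
    by_cases hz : z = 0
    · rw [hz, sphereInv_zero, sphereInv_infty]
    · rw [sphereInv_coe hz, sphereInv_coe (inv_ne_zero hz), inv_inv]

lemma sqrt_one_add_norm_inv {z : ℂ} (hz : z ≠ 0) :
    √(1 + ‖z⁻¹‖ ^ 2) = √(1 + ‖z‖ ^ 2) / ‖z‖ := by
  have hp : 0 < ‖z‖ := norm_pos_iff.2 hz
  rw [← Real.sqrt_sq hp.le, ← Real.sqrt_div (by positivity), Real.sqrt_sq hp.le, norm_inv]
  congr 1
  field_simp
  ring

lemma chordal_infty_coe (w : ℂ) :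
    chordal OnePoint.infty (w : OnePoint ℂ) = 2 / √(1 + ‖w‖ ^ 2) := rfl

lemma chordal_coe_coe (z w : ℂ) : chordal (z : OnePoint ℂ) (w : OnePoint ℂ) =
    2 * ‖z - w‖ / (√(1 + ‖z‖ ^ 2) * √(1 + ‖w‖ ^ 2)) := rfl

lemma chordal_sphereInv_infty (y : OnePoint ℂ) :
    chordal (sphereInv OnePoint.infty) (sphereInv y) = chordal OnePoint.infty y := by
  induction y using OnePoint.rec with
  | infty => rw [sphereInv_infty, chordal_coe_coe]; simp [chordal]
  | coe w =>
    rw [sphereInv_infty]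
    by_cases hw : w = 0
    · rw [hw, sphereInv_zero, chordal_comm]
    · have hp : 0 < ‖w‖ := norm_pos_iff.2 hw
      rw [sphereInv_coe hw, chordal_coe_coe, chordal_infty_coe, sqrt_one_add_norm_inv hw]
      simp only [zero_sub, norm_neg, norm_inv, norm_zero]
      field_simp
      simp

lemma chordal_sphereInv (x y : OnePoint ℂ) :
    chordal (sphereInv x) (sphereInv y) = chordal x y := by
  induction x using OnePoint.rec with
  | infty => exact chordal_sphereInv_infty y
  | coe z =>
    induction y using OnePoint.rec with
    | infty => rw [chordal_comm, chordal_sphereInv_infty, chordal_comm]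
    | coe w =>
      by_cases hz : z = 0
      · have := chordal_sphereInv_infty (sphereInv w)
        rw [sphereInv_sphereInv] at this
        rw [hz, sphereInv_zero, ← this, sphereInv_infty]
      by_cases hw : w = 0
      · have := chordal_sphereInv_infty (sphereInv z)
        rw [sphereInv_sphereInv] at this
        rw [hw, sphereInv_zero, chordal_comm, ← this, sphereInv_infty, chordal_comm]
      have hp : 0 < ‖w‖ := norm_pos_iff.2 hw
      have hp' : 0 < ‖z‖ := norm_pos_iff.2 hz
      rw [sphereInv_coe hw, sphereInv_coe hz, chordal_coe_coe, chordal_coe_coe,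
        sqrt_one_add_norm_inv hw, sqrt_one_add_norm_inv hz, inv_sub_inv hz hw, norm_div, norm_mul,
        norm_sub_rev]
      field_simp

/-- Points that are close in the chordal metric to a bounded point are close in the plane. -/
lemma exists_coe_of_chordal_lt {x : OnePoint ℂ} {w : ℂ} {B : ℝ} (hw : ‖w‖ ≤ B)
    (h : chordal x w < 1 / √(1 + B ^ 2)) :
    ∃ v : ℂ, x = v ∧ ‖v‖ ≤ 2 * B + 1 ∧ ‖v - w‖ ≤ (1 + (2 * B + 1) ^ 2) * chordal x w := by
  have hB : 0 ≤ B := (norm_nonneg _).trans hw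
  have hsw : √(1 + ‖w‖ ^ 2) ≤ √(1 + B ^ 2) := Real.sqrt_le_sqrt (by gcongr)
  have hsw0 : 0 < √(1 + ‖w‖ ^ 2) := Real.sqrt_pos.2 (by positivity)
  have hsB0 : 0 < √(1 + B ^ 2) := Real.sqrt_pos.2 (by positivity)
  induction x using OnePoint.rec with
  | infty =>
    exfalso
    rw [chordal_infty_coe, div_lt_div_iff₀ hsw0 hsB0] at h
    linarith
  | coe v =>
    have hsv0 : 0 < √(1 + ‖v‖ ^ 2) := Real.sqrt_pos.2 (by positivity)
    rw [chordal_coe_coe] at h ⊢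
    have hv : ‖v‖ ≤ 2 * B + 1 := by
      by_contra! hv
      rw [div_lt_div_iff₀ (by positivity) hsB0] at h
      have h1 : √(1 + ‖v‖ ^ 2) ≤ 1 + ‖v‖ := by
        rw [Real.sqrt_le_left (by positivity)]
        nlinarith [norm_nonneg v]
      have h2 : 1 + ‖v‖ ≤ 2 * ‖v - w‖ := by linarith [norm_sub_norm_le v w]
      have h3 : √(1 + ‖v‖ ^ 2) * √(1 + ‖w‖ ^ 2) ≤ 2 * ‖v - w‖ * √(1 + B ^ 2) := by gcongr; linarith
      linarith
    refine ⟨v, rfl, hv, ?_⟩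
    have hprod : √(1 + ‖v‖ ^ 2) * √(1 + ‖w‖ ^ 2) ≤ 1 + (2 * B + 1) ^ 2 := by
      have h1 : √(1 + ‖v‖ ^ 2) ≤ √(1 + (2 * B + 1) ^ 2) := Real.sqrt_le_sqrt (by gcongr)
      have h2 : √(1 + ‖w‖ ^ 2) ≤ √(1 + (2 * B + 1) ^ 2) :=
        Real.sqrt_le_sqrt (by gcongr; linarith)
      calc _ ≤ √(1 + (2 * B + 1) ^ 2) * √(1 + (2 * B + 1) ^ 2) := by gcongr
        _ = _ := Real.mul_self_sqrt (by positivity)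
    rw [mul_div_assoc', le_div_iff₀ (by positivity)]
    have := mul_le_mul_of_nonneg_right hprod (norm_nonneg (v - w))
    nlinarith [mul_nonneg (norm_nonneg (v - w)) (by positivity : (0:ℝ) ≤ 1 + (2 * B + 1) ^ 2)]

/-! ### Spherical limits of meromorphic functions. -/

lemma value_eq_coe {f : ℂ → ℂ} {z v : ℂ} (h : value f z = (v : OnePoint ℂ)) :
    0 ≤ meromorphicOrderAt f z ∧ f z = v := by
  unfold value at h
  split_ifs at h with h1
  · exact absurd h (OnePoint.infty_ne_coe _)
  · exact ⟨not_lt.1 h1, OnePoint.coe_injective h⟩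

lemma value_inv {f : ℂ → ℂ} (hf : MeromorphicNFOn f univ)
    (hord : ∀ a, meromorphicOrderAt f a ≠ ⊤) (z : ℂ) : value f⁻¹ z = sphereInv (value f z) := by
  have h0 := (hf (mem_univ z)).meromorphicOrderAt_eq_zero_iff
  have hc := coe_ord hord z
  unfold value
  rw [meromorphicOrderAt_inv, ← hc]
  rw [← hc] at h0
  rcases lt_trichotomy (ord f z) 0 with h | h | h
  · have h1 : ((ord f z : ℤ) : WithTop ℤ) < 0 := by exact_mod_cast h
    have h2 : ¬ -((ord f z : ℤ) : WithTop ℤ) < 0 := by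
      rw [← WithTop.LinearOrderedAddCommGroup.coe_neg]; norm_cast; omega
    have h3 : f z = 0 := by
      by_contra h'
      have := h0.2 h'
      norm_cast at this; omega
    simp [h1, h2, h3, sphereInv_infty]
  · have h3 : f z ≠ 0 := h0.1 (by rw [h]; rfl)
    rw [h]
    simp [sphereInv_coe h3]
  · have h1 : ¬ ((ord f z : ℤ) : WithTop ℤ) < 0 := by norm_cast; omega
    have h2 : -((ord f z : ℤ) : WithTop ℤ) < 0 := by
      rw [← WithTop.LinearOrderedAddCommGroup.coe_neg]; norm_cast; omega
    have h3 : f z = 0 := by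
      by_contra h'
      have := h0.2 h'
      norm_cast at this; omega
    simp [h1, h2, h3, sphereInv_zero]

lemma value_rescale (f : ℂ → ℂ) (h z : ℂ) {c l : ℂ} (hc : c ≠ 0) (hl : l ≠ 0) :
    value (fun z => c * f (h + l * z)) z =
      OnePoint.map (fun w : ℂ => c * w) (value f (h + l * z)) := by
  unfold value
  rw [meromorphicOrderAt_rescale h hc hl]
  split_ifs <;> rfl

lemma SphericalTendsto.sphereInv {G : ℕ → ℂ → OnePoint ℂ} {φ : ℂ → OnePoint ℂ}
    (h : SphericalTendsto G φ) :
    SphericalTendsto (fun n z => Yosida.sphereInv (G n z)) (fun z => Yosida.sphereInv (φ z)) := by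
  intro K hK ε hε
  simpa only [chordal_sphereInv] using h K hK ε hε

/-- Near a point where the spherical limit of meromorphic functions is finite, the convergence is
uniform convergence of holomorphic functions. -/
lemma exists_uniform_of_ne_infty {F : ℕ → ℂ → ℂ} {φ : ℂ → OnePoint ℂ}
    (hF : ∀ n, MeromorphicNFOn (F n) univ) (hord : ∀ n a, meromorphicOrderAt (F n) a ≠ ⊤)
    (h : SphericalTendsto (fun n => value (F n)) φ) {z₀ : ℂ} (hz₀ : φ z₀ ≠ OnePoint.infty) :
    ∃ ρ > 0, ∃ (ψ : ℂ → ℂ) (B : ℝ), DifferentiableOn ℂ ψ (Metric.ball z₀ ρ) ∧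
      (∀ z ∈ Metric.ball z₀ ρ, φ z = (ψ z : OnePoint ℂ) ∧ ‖ψ z‖ ≤ B) ∧
      TendstoUniformlyOn F ψ atTop (Metric.ball z₀ ρ) ∧
      ∀ᶠ n in atTop, ∀ z ∈ Metric.ball z₀ ρ, 0 ≤ ord (F n) z := by
  obtain ⟨w, hw⟩ := OnePoint.ne_infty_iff_exists.1 hz₀
  set B₂ := 2 * ‖w‖ + 1 + 1 with hB₂
  have hB₂0 : 0 ≤ B₂ := by positivity
  have hε : 0 < 1 / √(1 + B₂ ^ 2) := one_div_pos.2 (Real.sqrt_pos.2 (by positivity))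
  -- The limit is not known to be continuous. One fixed member `F N`, uniformly close to it and
  -- analytic at `z₀`, transfers local boundedness to the limit.
  obtain ⟨N, hN⟩ := h (Metric.closedBall z₀ 1) (isCompact_closedBall _ _) _ hε
  have hN0 : ∀ z ∈ Metric.closedBall z₀ 1, chordal (value (F N) z) (φ z) < 1 / √(1 + B₂ ^ 2) :=
    hN N le_rfl
  obtain ⟨v, hv, hvB, -⟩ := exists_coe_of_chordal_lt (B := ‖w‖) le_rfl (x := value (F N) z₀) (by
    rw [hw]
    refine (hN0 z₀ (by simp)).trans_le ?_
    have : ‖w‖ ≤ B₂ := by rw [hB₂]; linarith [norm_nonneg w]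
    have h1 : 0 < √(1 + ‖w‖ ^ 2) := Real.sqrt_pos.2 (by positivity)
    gcongr)
  obtain ⟨hv0, hv⟩ := value_eq_coe hv
  have han : AnalyticAt ℂ (F N) z₀ :=
    (hF N (mem_univ z₀)).meromorphicOrderAt_nonneg_iff_analyticAt.1 hv0
  have hlt : ∀ᶠ z in 𝓝 z₀, ‖F N z‖ < B₂ :=
    han.continuousAt.norm.eventually (gt_mem_nhds (by
      change ‖F N z₀‖ < B₂; rw [hv, hB₂]; linarith))
  obtain ⟨ρ, hρ, hball⟩ := Metric.eventually_nhds_iff_ball.1 (hlt.and han.eventually_analyticAt)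
  set r := min ρ 1 with hr
  have hr0 : 0 < r := lt_min hρ one_pos
  have hsub : Metric.ball z₀ r ⊆ Metric.closedBall z₀ 1 := fun z hz =>
    Metric.ball_subset_closedBall (Metric.ball_subset_ball (min_le_right _ _) hz)
  have hφ : ∀ z ∈ Metric.ball z₀ r, ∃ u : ℂ, φ z = (u : OnePoint ℂ) ∧ ‖u‖ ≤ 2 * B₂ + 1 := by
    intro z hz
    obtain ⟨h1, h2⟩ := hball z (Metric.ball_subset_ball (min_le_left _ _) hz)
    have hval : value (F N) z = (F N z : OnePoint ℂ) := by
      unfold value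
      rw [if_neg (not_lt.2 h2.meromorphicOrderAt_nonneg)]
    have h3 := hN0 z (hsub hz)
    rw [chordal_comm, hval] at h3
    obtain ⟨u, hu, hu', -⟩ := exists_coe_of_chordal_lt h1.le h3
    exact ⟨u, hu, hu'⟩
  choose! ψ hψ hψB using hφ
  set B := 2 * B₂ + 1 with hB
  have hεB : 0 < 1 / √(1 + B ^ 2) := one_div_pos.2 (Real.sqrt_pos.2 (by positivity))
  have key : ∀ ε > 0, ∀ᶠ n in atTop, ∀ z ∈ Metric.ball z₀ r,
      0 ≤ meromorphicOrderAt (F n) z ∧ ‖F n z - ψ z‖ < ε := by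
    intro ε hε
    have hC : 0 < 1 + (2 * B + 1) ^ 2 := by positivity
    obtain ⟨N', hN'⟩ := h (Metric.closedBall z₀ 1) (isCompact_closedBall _ _)
      (min (1 / √(1 + B ^ 2)) (ε / (1 + (2 * B + 1) ^ 2))) (lt_min hεB (by positivity))
    filter_upwards [eventually_ge_atTop N'] with n hn z hz
    have h1 := hN' n hn z (hsub hz)
    rw [hψ z hz] at h1
    obtain ⟨v, hv, -, hv'⟩ := exists_coe_of_chordal_lt (hψB z hz) (h1.trans_le (min_le_left _ _))
    obtain ⟨h2, rfl⟩ := value_eq_coe hv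
    refine ⟨h2, hv'.trans_lt ?_⟩
    have := h1.trans_le (min_le_right _ _)
    rwa [lt_div_iff₀' hC] at this
  have hunif : TendstoUniformlyOn F ψ atTop (Metric.ball z₀ r) := by
    rw [Metric.tendstoUniformlyOn_iff]
    intro ε hε
    filter_upwards [key ε hε] with n hn z hz
    rw [dist_comm, dist_eq_norm]
    exact (hn z hz).2
  refine ⟨r, hr0, ψ, B, ?_, fun z hz => ⟨hψ z hz, hψB z hz⟩, hunif, ?_⟩
  · refine hunif.tendstoLocallyUniformlyOn.differentiableOn ?_ Metric.isOpen_ball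
    filter_upwards [key 1 one_pos] with n hn z hz
    exact ((hF n (mem_univ z)).meromorphicOrderAt_nonneg_iff_analyticAt.1
      (hn z hz).1).differentiableAt.differentiableWithinAt
  · filter_upwards [key 1 one_pos] with n hn z hz
    have := (hn z hz).1
    rw [← coe_ord (hord n)] at this
    exact_mod_cast this

lemma SphericalTendsto.value_inv {F : ℕ → ℂ → ℂ} {φ : ℂ → OnePoint ℂ}
    (hF : ∀ n, MeromorphicNFOn (F n) univ) (hord : ∀ n a, meromorphicOrderAt (F n) a ≠ ⊤)
    (h : SphericalTendsto (fun n => value (F n)) φ) :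
    SphericalTendsto (fun n => value (F n)⁻¹) (fun z => Yosida.sphereInv (φ z)) := by
  have : (fun n => value (F n)⁻¹) = fun n z => Yosida.sphereInv (value (F n) z) := by
    ext n z
    rw [Yosida.value_inv (hF n) (hord n)]
  rw [this]
  exact h.sphereInv

lemma nf_inv {f : ℂ → ℂ} (hf : MeromorphicNFOn f univ) : MeromorphicNFOn f⁻¹ univ :=
  meromorphicNFOn_inv.2 hf

lemma order_inv_ne_top {f : ℂ → ℂ} (hord : ∀ a, meromorphicOrderAt f a ≠ ⊤) (a : ℂ) :
    meromorphicOrderAt f⁻¹ a ≠ ⊤ := by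
  rw [meromorphicOrderAt_inv, ← coe_ord hord a, ← WithTop.LinearOrderedAddCommGroup.coe_neg]
  exact WithTop.coe_ne_top

/-- The identity theorem for spherical limits of meromorphic functions. -/
lemma not_eventually_eq_zero {F : ℕ → ℂ → ℂ} {φ : ℂ → OnePoint ℂ}
    (hF : ∀ n, MeromorphicNFOn (F n) univ) (hord : ∀ n a, meromorphicOrderAt (F n) a ≠ ⊤)
    (h : SphericalTendsto (fun n => value (F n)) φ) (hφ : ¬ ∃ c, ∀ z, φ z = c) (z₀ : ℂ) :
    ¬ ∀ᶠ z in 𝓝 z₀, φ z = ((0 : ℂ) : OnePoint ℂ) := by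
  intro hz₀
  set S : Set ℂ := {z | ∀ᶠ w in 𝓝 z, φ w = ((0 : ℂ) : OnePoint ℂ)} with hS
  have hopen : IsOpen S := isOpen_setOfPred_eventually_nhds
  -- At a limit point where the limit is finite, the identity theorem for the holomorphic
  -- representative applies. A limit point with value ∞ is impossible, since the inverted limit is
  -- finite nearby but would be ∞ at points of `S`.
  have hclosed : IsClosed S := by
    refine isClosed_of_closure_subset fun z hz => ?_
    rw [Metric.mem_closure_iff] at hz
    by_cases hzi : φ z = OnePoint.infty
    · obtain ⟨ρ, hρ, ψ, _, -, hψ, -, -⟩ := exists_uniform_of_ne_infty (z₀ := z)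
        (fun n => nf_inv (hF n)) (fun n => order_inv_ne_top (hord n))
        (SphericalTendsto.value_inv hF hord h) (by rw [hzi, sphereInv_infty]; simp)
      obtain ⟨y, hy, hyz⟩ := hz ρ hρ
      have h1 := (hψ y (by rwa [Metric.mem_ball, dist_comm])).1
      rw [Filter.Eventually.self_of_nhds hy, sphereInv_zero] at h1
      exact absurd h1 (OnePoint.infty_ne_coe _)
    · obtain ⟨ρ, hρ, ψ, _, hd, hψ, -, -⟩ := exists_uniform_of_ne_infty hF hord h hzi
      obtain ⟨y, hy, hyz⟩ := hz ρ hρ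
      have hyb : y ∈ Metric.ball z ρ := by rwa [Metric.mem_ball, dist_comm]
      have h1 : ψ =ᶠ[𝓝 y] 0 := by
        filter_upwards [hy, Metric.isOpen_ball.mem_nhds hyb] with w hw hwb
        rw [(hψ w hwb).1] at hw
        exact OnePoint.coe_injective hw
      have h2 := (hd.analyticOnNhd Metric.isOpen_ball).eqOn_zero_of_preconnected_of_eventuallyEq_zero
        (convex_ball z ρ).isPreconnected hyb h1
      filter_upwards [Metric.isOpen_ball.mem_nhds (Metric.mem_ball_self hρ)] with w hw
      rw [(hψ w hw).1, h2 hw]; rfl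
  have huniv : S = univ := IsClopen.eq_univ ⟨hclosed, hopen⟩ ⟨z₀, hz₀⟩
  refine hφ ⟨((0 : ℂ) : OnePoint ℂ), fun z => ?_⟩
  have hz : z ∈ S := huniv ▸ mem_univ z
  exact Filter.Eventually.self_of_nhds (p := fun w => φ w = ((0 : ℂ) : OnePoint ℂ)) hz

/-! ### Control near the origin for a convergent sequence. -/

/-- Uniform control, near the origin, of the zeros, the poles and the logarithmic derivative. -/
def LocalControl (F : ℂ → ℂ) (C s : ℝ) : Prop :=
  ∃ Z : Finset ℂ, (∀ a, a ∈ Z ↔ ‖a‖ < s ∧ ord F a ≠ 0) ∧ ∑ a ∈ Z, |(ord F a : ℝ)| ≤ C ∧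
    (ord F 0 = 0 → ‖logDeriv F 0‖ ≤ C + ∑ a ∈ Z, |(ord F a : ℝ)| / ‖a‖)

/-- Passing to the reciprocal only changes signs of orders and of the logarithmic derivative. This
is how a limit with a pole at the origin is reduced to a finite one. -/
lemma LocalControl.of_inv {F : ℂ → ℂ} (hF : MeromorphicNFOn F univ)
    (hord : ∀ a, meromorphicOrderAt F a ≠ ⊤) {C s : ℝ} (h : LocalControl F⁻¹ C s) :
    LocalControl F C s := by
  obtain ⟨Z, hZ, hsum, hl⟩ := h
  simp only [ord_inv, neg_eq_zero, Int.cast_neg, abs_neg, ne_eq] at hZ hsum hl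
  refine ⟨Z, hZ, hsum, fun h0 => ?_⟩
  convert hl h0 using 1
  have hd : DifferentiableAt ℂ F 0 :=
    ((hF (mem_univ 0)).meromorphicOrderAt_nonneg_iff_analyticAt.1
      (by rw [← coe_ord hord, h0]; rfl)).differentiableAt
  have h1 := logDeriv_fun_zpow hd (-1)
  have h2 : (fun x => F x ^ (-1 : ℤ)) = F⁻¹ := by ext; simp
  rw [h2] at h1
  rw [h1]
  simp

/-- The zeros of the nonconstant limit are isolated, so some small circle about 0 avoids them. By
uniform convergence the functions inherit, from some index on, an upper bound on the disc and a
lower bound on that circle. -/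
lemma exists_localControl_of_ne_infty {F : ℕ → ℂ → ℂ} {φ : ℂ → OnePoint ℂ}
    (hF : ∀ n, MeromorphicNFOn (F n) univ) (hord : ∀ n a, meromorphicOrderAt (F n) a ≠ ⊤)
    (h : SphericalTendsto (fun n => value (F n)) φ) (hφ : ¬ ∃ c, ∀ z, φ z = c)
    (h0 : φ 0 ≠ OnePoint.infty) : ∃ C s, 0 < s ∧ ∀ᶠ n in atTop, LocalControl (F n) C s := by
  obtain ⟨ρ, hρ, ψ, B, hd, hψ, hunif, hpos⟩ := exists_uniform_of_ne_infty hF hord h h0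
  have han : AnalyticAt ℂ ψ 0 := hd.analyticOnNhd Metric.isOpen_ball 0 (Metric.mem_ball_self hρ)
  have hne : ∀ᶠ z in 𝓝[≠] (0 : ℂ), ψ z ≠ 0 := by
    refine han.eventually_eq_zero_or_eventually_ne_zero.resolve_left fun h1 => ?_
    refine not_eventually_eq_zero hF hord h hφ 0 ?_
    filter_upwards [h1, Metric.isOpen_ball.mem_nhds (Metric.mem_ball_self hρ)] with z hz hzb
    rw [(hψ z hzb).1, hz]
  obtain ⟨δ, hδ, hne⟩ := Metric.eventually_nhds_iff_ball.1 (eventually_nhdsWithin_iff.1 hne)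
  -- Seven rather than six, so that the closed disc of radius 6s lies inside the open ball.
  set s := min ρ δ / 7 with hs
  have hm : 0 < min ρ δ := lt_min hρ hδ
  have hs0 : 0 < s := by positivity
  have hsρ : 6 * s < ρ := by linarith [min_le_left ρ δ]
  have hsδ : s < δ := by linarith [min_le_right ρ δ]
  have hsub : Metric.closedBall (0 : ℂ) (6 * s) ⊆ Metric.ball 0 ρ :=
    Metric.closedBall_subset_ball hsρ
  have hsub' : Metric.sphere (0 : ℂ) s ⊆ Metric.ball 0 ρ :=
    (Metric.sphere_subset_closedBall.trans
      (Metric.closedBall_subset_closedBall (by linarith))).trans hsub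
  obtain ⟨y, hy, hymin⟩ := (isCompact_sphere (0 : ℂ) s).exists_isMinOn
    (NormedSpace.sphere_nonempty.2 hs0.le) (hd.continuousOn.mono hsub').norm
  have hη : 0 < ‖ψ y‖ := by
    rw [norm_pos_iff]
    have hys := mem_sphere_zero_iff_norm.1 hy
    refine hne y (by rw [mem_ball_zero_iff, hys]; exact hsδ) ?_
    rintro rfl
    rw [norm_zero] at hys
    exact hs0.ne hys
  set η := ‖ψ y‖ / 2 with hηdef
  have hη0 : 0 < η := by positivity
  have hB0 : 0 ≤ B := (norm_nonneg _).trans (hψ 0 (Metric.mem_ball_self hρ)).2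
  refine ⟨(B + 1) / η + (B + 1) / (η * s), s, hs0, ?_⟩
  rw [Metric.tendstoUniformlyOn_iff] at hunif
  filter_upwards [hpos, hunif (min 1 η) (lt_min one_pos hη0)] with n hn1 hn2
  obtain ⟨Z, hZ, hsum, hl⟩ := zeros_and_logDeriv_bound (hF n) (hord n) (B := B + 1) hs0 hη0
    (fun z hz => hn1 z (hsub hz))
    (fun z hz => by
      have h1 := (hn2 z (hsub hz)).trans_le (min_le_left _ _)
      rw [dist_comm, dist_eq_norm] at h1
      linarith [(hψ z (hsub hz)).2, norm_sub_norm_le (F n z) (ψ z)])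
    (fun z hz => by
      have h1 := (hn2 z (hsub' hz)).trans_le (min_le_right _ _)
      rw [dist_eq_norm] at h1
      have h2 : ‖ψ y‖ ≤ ‖ψ z‖ := hymin hz
      linarith [norm_sub_norm_le (ψ z) (F n z)])
  have e1 : 0 ≤ (B + 1) / η := by positivity
  have e2 : 0 ≤ (B + 1) / (η * s) := by positivity
  exact ⟨Z, hZ, by linarith, fun h0 => by linarith [hl h0]⟩

lemma exists_localControl {F : ℕ → ℂ → ℂ} {φ : ℂ → OnePoint ℂ}
    (hF : ∀ n, MeromorphicNFOn (F n) univ) (hord : ∀ n a, meromorphicOrderAt (F n) a ≠ ⊤)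
    (h : SphericalTendsto (fun n => value (F n)) φ) (hφ : ¬ ∃ c, ∀ z, φ z = c) :
    ∃ C s, 0 < s ∧ ∀ᶠ n in atTop, LocalControl (F n) C s := by
  by_cases h0 : φ 0 = OnePoint.infty
  · obtain ⟨C, s, hs, hC⟩ := exists_localControl_of_ne_infty (fun n => nf_inv (hF n))
      (fun n => order_inv_ne_top (hord n)) (SphericalTendsto.value_inv hF hord h)
      (fun ⟨c, hc⟩ => hφ ⟨sphereInv c, fun z => by rw [← hc z, sphereInv_sphereInv]⟩)
      (by rw [h0, sphereInv_infty]; simp)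
    exact ⟨C, s, hs, hC.mono fun n hn => hn.of_inv (hF n) (hord n)⟩
  · exact exists_localControl_of_ne_infty hF hord h hφ h0

/-- Infinite order at one point propagates through the connected plane and forces f = 0, which is
rational. -/
lemma GeneralisedYosida.order_ne_top {α β : ℝ} {f : ℂ → ℂ} (hf : GeneralisedYosida α β f) (a : ℂ) :
    meromorphicOrderAt f a ≠ ⊤ := by
  intro ha
  refine hf.transcendental ⟨0, 1, one_ne_zero, fun z _ => ?_⟩
  have hz : meromorphicOrderAt f z = ⊤ := by
    by_contra hz
    exact MeromorphicOn.meromorphicOrderAt_ne_top_of_isPreconnected hf.meromorphic.meromorphicOn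
      isPreconnected_univ (mem_univ z) (mem_univ a) hz ha
  have : f z = 0 := by
    by_contra! h
    rw [← (hf.meromorphic (mem_univ z)).meromorphicOrderAt_eq_zero_iff, hz] at h
    exact absurd h (by simp)
  simp [this]

/-! ### Uniform bounds at the scale |h|^(-β). -/

/-- Bounds at scale `‖h‖ ^ (-β)` for the zeros, the poles and the logarithmic derivative. -/
def ScaleControl (f : ℂ → ℂ) (β : ℝ) (N : ℕ) (h : ℂ) : Prop :=
  (∀ A : Finset ℂ, (∀ a ∈ A, ‖a - h‖ < ‖h‖ ^ (-β) / N) → ∑ a ∈ A, |(ord f a : ℝ)| ≤ N) ∧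
  (ord f h = 0 → ∃ A : Finset ℂ, (∀ a ∈ A, ‖a - h‖ < ‖h‖ ^ (-β) / (2 * N) ∧ ord f a ≠ 0) ∧
    ‖logDeriv f h‖ ≤ (N : ℝ) ^ 2 * ‖h‖ ^ β + ∑ a ∈ A, |(ord f a : ℝ)| / ‖a - h‖)

lemma logDeriv_rescale (f : ℂ → ℂ) (h z : ℂ) {c : ℂ} (l : ℂ) (hc : c ≠ 0) :
    logDeriv (fun z => c * f (h + l * z)) z = l * logDeriv f (h + l * z) := by
  rw [logDeriv_const_mul z c hc, logDeriv_apply, logDeriv_apply, mul_div_assoc']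
  congr 1
  have h1 := deriv_comp_mul_left l (fun w => f (h + w)) z
  rw [smul_eq_mul, deriv_comp_const_add] at h1
  exact h1

lemma LocalControl.scaleControl {f : ℂ → ℂ} {β : ℝ} {h c l : ℂ} (hc : c ≠ 0) (hh : h ≠ 0)
    (hl : ‖l‖ = ‖h‖ ^ (-β)) {C s : ℝ} (H : LocalControl (fun z => c * f (h + l * z)) C s)
    {N : ℕ} (hN : 0 < N) (hNs : 1 / (N : ℝ) ≤ s) (hNC : 3 * C ≤ N) : ScaleControl f β N h := by
  classical
  obtain ⟨Z, hZ, hsum, hlog⟩ := H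
  have hh0 : 0 < ‖h‖ := norm_pos_iff.2 hh
  have hl0 : 0 < ‖l‖ := by rw [hl]; positivity
  have hl' : l ≠ 0 := norm_pos_iff.1 hl0
  have hN0 : (0 : ℝ) < N := by exact_mod_cast hN
  have hN1 : (1 : ℝ) ≤ N := by exact_mod_cast hN
  have hC0 : 0 ≤ C := (Finset.sum_nonneg fun _ _ => abs_nonneg _).trans hsum
  have hordF : ∀ a, ord (fun z => c * f (h + l * z)) a = ord f (h + l * a) := fun a => by
    rw [ord, ord, meromorphicOrderAt_rescale h hc hl']
  simp only [hordF] at hZ hsum hlog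
  rw [logDeriv_rescale f h 0 l hc] at hlog
  simp only [mul_zero, add_zero, norm_mul] at hlog
  constructor
  · intro A hA
    have hinj : Set.InjOn (fun a => (a - h) / l) (A.filter (ord f · ≠ 0)) := by
      intro x _ y _ hxy
      simpa [div_left_inj' hl'] using hxy
    have hback : ∀ a : ℂ, h + l * ((a - h) / l) = a := fun a => by field_simp; ring
    calc ∑ a ∈ A, |(ord f a : ℝ)| = ∑ a ∈ A.filter (ord f · ≠ 0), |(ord f a : ℝ)| := by
          rw [Finset.sum_filter_of_ne]
          intro a _ h1 h2
          simp [h2] at h1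
      _ = ∑ w ∈ (A.filter (ord f · ≠ 0)).image (fun a => (a - h) / l),
            |(ord f (h + l * w) : ℝ)| := by
          rw [Finset.sum_image hinj]
          simp only [hback]
      _ ≤ ∑ w ∈ Z, |(ord f (h + l * w) : ℝ)| := by
          refine Finset.sum_le_sum_of_subset_of_nonneg (fun w hw => ?_) fun _ _ _ => abs_nonneg _
          obtain ⟨a, ha, rfl⟩ := Finset.mem_image.1 hw
          obtain ⟨ha, ha0⟩ := Finset.mem_filter.1 ha
          rw [hZ, hback]
          refine ⟨?_, ha0⟩
          rw [norm_div, div_lt_iff₀ hl0, hl]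
          refine (hA a ha).trans_le ?_
          rw [div_eq_mul_one_div, mul_comm]
          gcongr
      _ ≤ N := by linarith
  · intro h0
    have h1 := hlog h0
    refine ⟨(Z.filter (‖·‖ < 1 / (2 * N))).image (fun w => h + l * w), fun a ha => ?_, ?_⟩
    · obtain ⟨w, hw, rfl⟩ := Finset.mem_image.1 ha
      obtain ⟨hw, hw1⟩ := Finset.mem_filter.1 hw
      refine ⟨?_, ((hZ w).1 hw).2⟩
      rw [add_sub_cancel_left, norm_mul, hl, div_eq_mul_one_div]
      gcongr
    · have hinj : Set.InjOn (fun w => h + l * w) (Z.filter (‖·‖ < 1 / (2 * (N : ℝ)))) := by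
        intro x _ y _ hxy
        simpa [hl'] using hxy
      rw [Finset.sum_image hinj]
      simp only [add_sub_cancel_left, norm_mul]
      rw [← Finset.sum_filter_add_sum_filter_not Z (‖·‖ < 1 / (2 * (N : ℝ)))] at h1
      -- Points at distance at least 1/(2N) contribute at most 2N each, and are absorbed into the
      -- constant: C + 2NC ≤ 3NC ≤ N².
      have h2 : ∑ w ∈ Z.filter (¬ ‖·‖ < 1 / (2 * (N : ℝ))), |(ord f (h + l * w) : ℝ)| / ‖w‖ ≤
          C * (2 * N) := by
        calc _ ≤ ∑ w ∈ Z.filter (¬ ‖·‖ < 1 / (2 * (N : ℝ))),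
              |(ord f (h + l * w) : ℝ)| * (2 * N) := by
              refine Finset.sum_le_sum fun w hw => ?_
              have := not_lt.1 (Finset.mem_filter.1 hw).2
              rw [div_eq_mul_inv]
              refine mul_le_mul_of_nonneg_left ?_ (abs_nonneg _)
              rw [inv_le_comm₀ (lt_of_lt_of_le (by positivity) this) (by positivity)]
              simpa using this
          _ = (∑ w ∈ Z.filter (¬ ‖·‖ < 1 / (2 * (N : ℝ))), |(ord f (h + l * w) : ℝ)|) *
              (2 * N) := by rw [Finset.sum_mul]
          _ ≤ C * (2 * N) := by
              gcongr
              exact (Finset.sum_le_sum_of_subset_of_nonneg (Finset.filter_subset _ _)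
                fun _ _ _ => abs_nonneg _).trans hsum
      have h3 : C + C * (2 * N) ≤ (N : ℝ) ^ 2 := by nlinarith
      have h4 : ‖h‖ ^ β = ‖l‖⁻¹ := by rw [hl, ← Real.rpow_neg hh0.le, neg_neg]
      have h5 : ∑ w ∈ Z.filter (‖·‖ < 1 / (2 * (N : ℝ))),
          |(ord f (h + l * w) : ℝ)| / (‖l‖ * ‖w‖) = ‖l‖⁻¹ *
          ∑ w ∈ Z.filter (‖·‖ < 1 / (2 * (N : ℝ))), |(ord f (h + l * w) : ℝ)| / ‖w‖ := by
        rw [Finset.mul_sum]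
        refine Finset.sum_congr rfl fun w _ => ?_
        rw [div_mul_eq_div_div, div_right_comm, inv_mul_eq_div]
      rw [h5, h4, mul_comm (_ ^ 2), ← mul_add, inv_mul_eq_div, le_div_iff₀ hl0, mul_comm]
      linarith

/-- By contradiction and compactness: points h_n → ∞ at which the bound fails with N = n + 1 have a
subsequence of convergent rescalings. Their common local constants are eventually beaten by the
growing N. A single integer serves as bound, inverse radius and threshold so that one sequence
refutes everything at once. -/
lemma GeneralisedYosida.exists_scaleControl {α β : ℝ} {f : ℂ → ℂ} (hf : GeneralisedYosida α β f) :
    ∃ N : ℕ, 0 < N ∧ ∀ h : ℂ, (N : ℝ) ≤ ‖h‖ → ScaleControl f β N h := by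
  by_contra! hcon
  have hcon' : ∀ n : ℕ, ∃ h : ℂ, ((n + 1 : ℕ) : ℝ) ≤ ‖h‖ ∧ ¬ ScaleControl f β (n + 1) h :=
    fun n => hcon (n + 1) n.succ_pos
  choose h hh hnot using hcon'
  have hge : ∀ n : ℕ, (n : ℝ) + 1 ≤ ‖h n‖ := fun n => by exact_mod_cast hh n
  have hge1 : ∀ n, 1 ≤ ‖h n‖ := fun n => le_trans (by linarith [n.cast_nonneg (α := ℝ)]) (hge n)
  obtain ⟨σ, hσ, φ, hφ⟩ := hf.normal h hge1
  have htop : Tendsto (fun n => ‖h (σ n)‖) atTop atTop := by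
    refine tendsto_atTop_mono (fun n => ?_) tendsto_natCast_atTop_atTop
    have : (n : ℝ) ≤ σ n := by exact_mod_cast hσ.id_le n
    linarith [hge (σ n)]
  have hnc := hf.nonconstant (fun n => h (σ n)) φ (fun n => hge1 _) htop hφ
  have hne : ∀ n, h n ≠ 0 := fun n => norm_pos_iff.1 (one_pos.trans_le (hge1 n))
  have hpow : ∀ n (x : ℂ), h n ^ x ≠ 0 := fun n x => by simp [Complex.cpow_eq_zero_iff, hne n]
  set F : ℕ → ℂ → ℂ := fun n z =>
    h (σ n) ^ (-(α : ℂ)) * f (h (σ n) + h (σ n) ^ (-(β : ℂ)) * z) with hF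
  have hφ' : SphericalTendsto (fun n => value (F n)) φ := by
    have : (fun n => value (F n)) = fun n => rescale f α β (h (σ n)) := by
      ext n z
      rw [hF, value_rescale f _ _ (hpow _ _) (hpow _ _)]
      rfl
    rwa [this]
  obtain ⟨C, s, hs, hC⟩ := exists_localControl
    (fun n => meromorphicNFOn_rescale hf.meromorphic (h (σ n)) (hpow _ _) (hpow _ _))
    (fun n a => by rw [meromorphicOrderAt_rescale _ (hpow _ _) (hpow _ _)]; exact hf.order_ne_top _) hφ' hnc
  have hσtop : Tendsto (fun n => ((σ n : ℕ) : ℝ) + 1) atTop atTop :=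
    tendsto_atTop_add_const_right _ _ (tendsto_natCast_atTop_atTop.comp hσ.tendsto_atTop)
  obtain ⟨n, hn, hn1, hn2⟩ := (hC.and ((hσtop.eventually_ge_atTop (1 / s)).and
    (hσtop.eventually_ge_atTop (3 * C)))).exists
  refine hnot (σ n) (hn.scaleControl (hpow _ _) (hne _) ?_ (Nat.succ_pos _) ?_ ?_)
  · rw [← Complex.ofReal_neg, Complex.norm_cpow_real]
  · push_cast
    rwa [one_div_le (by positivity) hs]
  · push_cast
    exact hn2

/-! ### Zeros and poles in thin annuli, and circles that avoid them. -/

lemma exists_dist_circleMap_le {t : ℝ} (ht : 0 < t) {J : ℕ} (hJ : 0 < J) (a : ℂ) :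
    ∃ j ∈ Finset.range (J + 1),
      ‖a - circleMap 0 t (2 * Real.pi / J * j - Real.pi)‖ ≤ |‖a‖ - t| + t * (2 * Real.pi / J) := by
  have hpi := Real.pi_pos
  have hJ0 : (0 : ℝ) < J := by exact_mod_cast hJ
  set d := 2 * Real.pi / J with hd
  have hd0 : 0 < d := by positivity
  set x := (Complex.arg a + Real.pi) / d with hx
  have hx0 : 0 ≤ x := div_nonneg (by linarith [Complex.neg_pi_lt_arg a]) hd0.le
  have hxJ : x ≤ J := by
    rw [hx, div_le_iff₀ hd0, hd, mul_div_cancel₀ _ hJ0.ne']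
    linarith [Complex.arg_le_pi a]
  refine ⟨⌊x⌋₊, ?_, ?_⟩
  · rw [Finset.mem_range, Nat.lt_succ_iff]
    exact Nat.floor_le_of_le hxJ
  · have h1 : ‖a - circleMap 0 t (Complex.arg a)‖ = |‖a‖ - t| := by
      have : a - circleMap 0 t (Complex.arg a) =
          ((‖a‖ - t : ℝ) : ℂ) * Complex.exp (Complex.arg a * Complex.I) := by
        rw [circleMap_zero, Complex.ofReal_sub, sub_mul, Complex.norm_mul_exp_arg_mul_I]
      rw [this, norm_mul, Complex.norm_exp_ofReal_mul_I, mul_one, Complex.norm_real,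
        Real.norm_eq_abs]
    have h2 : ‖circleMap 0 t (Complex.arg a) - circleMap 0 t (d * ⌊x⌋₊ - Real.pi)‖ ≤ t * d := by
      have := (lipschitzWith_circleMap 0 t).dist_le_mul (Complex.arg a) (d * ⌊x⌋₊ - Real.pi)
      rw [dist_eq_norm, Real.dist_eq, Real.coe_nnabs, abs_of_pos ht] at this
      refine this.trans (mul_le_mul_of_nonneg_left ?_ ht.le)
      have h3 : Complex.arg a - (d * ⌊x⌋₊ - Real.pi) = d * (x - ⌊x⌋₊) := by
        rw [hx]; field_simp; ring
      rw [h3, abs_mul, abs_of_pos hd0, abs_of_nonneg (sub_nonneg.2 (Nat.floor_le hx0))]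
      nlinarith [Nat.lt_floor_add_one x]
    calc _ ≤ ‖a - circleMap 0 t (Complex.arg a)‖ +
        ‖circleMap 0 t (Complex.arg a) - circleMap 0 t (d * ⌊x⌋₊ - Real.pi)‖ :=
          norm_sub_le_norm_sub_add_norm_sub _ _ _
      _ ≤ _ := by rw [h1]; gcongr

/-- The number of zeros and poles in a thin annulus of radius `t`. -/
lemma sum_ord_annulus_le {f : ℂ → ℂ} {β : ℝ} (hβ : -1 < β) {N : ℕ} (hN : 0 < N)
    (H : ∀ h : ℂ, (N : ℝ) ≤ ‖h‖ → ScaleControl f β N h) {t : ℝ} (ht : (N : ℝ) ≤ t) {A : Finset ℂ}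
    (hA : ∀ a ∈ A, |‖a‖ - t| ≤ t ^ (-β) / (2 * N)) :
    ∑ a ∈ A, |(ord f a : ℝ)| ≤ ((4 * Real.pi * N + 2) * N) * t ^ (1 + β) := by
  classical
  have hpi := Real.pi_pos
  have hN0 : (0 : ℝ) < N := by exact_mod_cast hN
  have hN1 : (1 : ℝ) ≤ N := by exact_mod_cast hN
  have ht0 : 0 < t := hN0.trans_le ht
  have hx1 : 1 ≤ t ^ (1 + β) := Real.one_le_rpow (hN1.trans ht) (by linarith)
  -- Chosen so that the arc step 2πt/J is below t^(-β)/(2N). Together with the half-width of the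
  -- annulus this stays below t^(-β)/N, the radius in which `ScaleControl` counts.
  set J := ⌊4 * Real.pi * N * t ^ (1 + β)⌋₊ + 1 with hJ
  have hJ1 : 4 * Real.pi * N * t ^ (1 + β) < J := by
    rw [hJ]; push_cast; exact Nat.lt_floor_add_one _
  have hJ2 : (J : ℝ) ≤ 4 * Real.pi * N * t ^ (1 + β) + 1 := by
    rw [hJ]; push_cast; gcongr; exact Nat.floor_le (by positivity)
  have hJ0 : (0 : ℝ) < J := by rw [hJ]; positivity
  choose g hg hgd using fun a => exists_dist_circleMap_le ht0 (J := J) (Nat.succ_pos _) a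
  rw [← Finset.sum_fiberwise_of_maps_to (s := A) (t := Finset.range (J + 1)) (fun a _ => hg a)]
  have hstep : t * (2 * Real.pi / J) < t ^ (-β) / (2 * N) := by
    have hp : t ^ (1 + β) * t ^ (-β) = t := by
      rw [← Real.rpow_add ht0]; simp
    rw [mul_div_assoc', div_lt_div_iff₀ hJ0 (by positivity)]
    have := mul_lt_mul_of_pos_left hJ1 (Real.rpow_pos_of_pos ht0 (-β))
    calc t * (2 * Real.pi) * (2 * N) = (t ^ (1 + β) * t ^ (-β)) * (2 * Real.pi) * (2 * N) := by
          rw [hp]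
      _ = t ^ (-β) * (4 * Real.pi * N * t ^ (1 + β)) := by ring
      _ < _ := this
  calc _ ≤ ∑ j ∈ Finset.range (J + 1), (N : ℝ) := by
        refine Finset.sum_le_sum fun j _ => ?_
        have hnorm : ‖circleMap 0 t (2 * Real.pi / J * j - Real.pi)‖ = t := by
          rw [norm_circleMap_zero, abs_of_pos ht0]
        refine (H (circleMap 0 t (2 * Real.pi / J * j - Real.pi)) (by rwa [hnorm])).1 _ ?_
        intro a ha
        obtain ⟨haA, rfl⟩ := Finset.mem_filter.1 ha
        rw [hnorm]
        calc _ ≤ |‖a‖ - t| + t * (2 * Real.pi / J) := hgd a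
          _ < t ^ (-β) / (2 * N) + t ^ (-β) / (2 * N) := add_lt_add_of_le_of_lt (hA a haA) hstep
          _ = _ := by field_simp; norm_num
    _ = (J + 1) * N := by simp
    _ ≤ _ := by
      rw [mul_right_comm]
      refine mul_le_mul_of_nonneg_right ?_ hN0.le
      nlinarith

/-- By length: intervals of length 2δ about the points of `S` cannot cover an interval of length w -
2δ. -/
lemma exists_far_from_finset (S : Finset ℝ) (r : ℝ) {w δ : ℝ} (hδ : 0 < δ)
    (h : 2 * δ * (S.card + 1) < w) :
    ∃ t, r + δ ≤ t ∧ t ≤ r + w - δ ∧ ∀ x ∈ S, δ ≤ |x - t| := by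
  by_contra! hcon
  have hsub : Icc (r + δ) (r + w - δ) ⊆ ⋃ x ∈ S, Metric.ball x δ := by
    intro t ht
    obtain ⟨x, hx, hxt⟩ := hcon t ht.1 ht.2
    rw [mem_iUnion₂]
    exact ⟨x, hx, by rwa [Metric.mem_ball, dist_comm, Real.dist_eq]⟩
  have h1 := (MeasureTheory.measure_mono hsub).trans
    (MeasureTheory.measure_biUnion_finset_le (μ := MeasureTheory.volume) S _)
  simp only [Real.volume_Icc, Real.volume_ball, Finset.sum_const, nsmul_eq_mul] at h1
  rw [← ENNReal.ofReal_natCast, ← ENNReal.ofReal_mul (by positivity),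
    ENNReal.ofReal_le_ofReal_iff (by positivity)] at h1
  nlinarith

/-- Circles close to `|z| = r` that stay away from all zeros and poles. -/
lemma exists_good_radius {f : ℂ → ℂ} (hf : MeromorphicNFOn f univ)
    (hord : ∀ a, meromorphicOrderAt f a ≠ ⊤) {r w M : ℝ} (hw : 0 < w)
    (hM : ∀ A : Finset ℂ, (∀ a ∈ A, r ≤ ‖a‖ ∧ ‖a‖ ≤ r + w) → ∑ a ∈ A, |(ord f a : ℝ)| ≤ M) :
    ∃ t, r ≤ t ∧ t ≤ r + w ∧ ∀ a, ord f a ≠ 0 → w / (2 * (M + 2)) ≤ |‖a‖ - t| := by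
  classical
  have hM0 : 0 ≤ M := by simpa using hM ∅ (by simp)
  obtain ⟨Z, -, hZ, -⟩ := exists_factorization hf hord 0 (r + w)
  set A := Z.filter (r ≤ ‖·‖) with hA
  have hcard : (A.card : ℝ) ≤ M := by
    refine le_trans ?_ (hM A fun a ha => ?_)
    · rw [Finset.card_eq_sum_ones, Nat.cast_sum]
      refine Finset.sum_le_sum fun a ha => ?_
      have := ((hZ a).1 (Finset.mem_filter.1 ha).1).2
      rw [← Int.cast_abs]
      exact_mod_cast Int.one_le_abs this
    · obtain ⟨h1, h2⟩ := Finset.mem_filter.1 ha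
      exact ⟨h2, mem_closedBall_zero_iff.1 ((hZ a).1 h1).1⟩
  have hSc : ((A.image (‖·‖)).card : ℝ) ≤ M :=
    le_trans (by exact_mod_cast Finset.card_image_le) hcard
  set δ := w / (2 * (M + 2)) with hδ
  have hδ0 : 0 < δ := by positivity
  obtain ⟨t, h1, h2, h3⟩ := exists_far_from_finset (A.image (‖·‖)) r (w := w) hδ0 (by
    have : 2 * δ * (M + 2) = w := by rw [hδ]; field_simp
    nlinarith)
  refine ⟨t, by linarith, by linarith, fun a ha => ?_⟩
  by_cases har : r ≤ ‖a‖
  · by_cases haw : ‖a‖ ≤ r + w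
    · exact h3 _ (Finset.mem_image_of_mem _ (Finset.mem_filter.2
        ⟨(hZ a).2 ⟨mem_closedBall_zero_iff.2 haw, ha⟩, har⟩))
    · rw [le_abs]; left; linarith
  · rw [le_abs]; right; linarith

/-! ### The integral of 1/|a - ζ| over a circle. -/

lemma abs_sub_le_norm_exp_sub {t s : ℝ} (ht : 0 < t) (hs : 0 ≤ s) (u : ℝ) :
    |s - t| ≤ ‖(t : ℂ) * Complex.exp (Complex.I * u) - s‖ := by
  have hn : ‖(t : ℂ) * Complex.exp (Complex.I * u)‖ = t := by
    rw [norm_mul, mul_comm Complex.I, Complex.norm_exp_ofReal_mul_I, Complex.norm_real,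
      Real.norm_eq_abs, abs_of_pos ht, mul_one]
  have := abs_norm_sub_norm_le ((s : ℝ) : ℂ) ((t : ℂ) * Complex.exp (Complex.I * u))
  rwa [hn, Complex.norm_real, Real.norm_eq_abs, abs_of_nonneg hs, norm_sub_rev] at this

/-- The distance dominates both the radial gap and, by Jordan's inequality for the sine, the angular
term t|u|/π; adding the two bounds gives the factor 2. -/
lemma le_norm_exp_sub {t s δ u : ℝ} (ht : 0 < t) (hs0 : 0 ≤ s) (hδ : δ ≤ |s - t|) (hu : |u| ≤ Real.pi) :
    δ + t * |u| / Real.pi ≤ 2 * ‖(t : ℂ) * Complex.exp (Complex.I * u) - s‖ := by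
  have hpi := Real.pi_pos
  have h1 : ‖(t : ℂ) * (Complex.exp (Complex.I * u) - 1)‖ = t * (2 * |Real.sin (u / 2)|) := by
    rw [norm_mul, Complex.norm_exp_I_mul_ofReal_sub_one, Complex.norm_real, Real.norm_eq_abs,
      abs_of_pos ht, Real.norm_eq_abs, abs_mul, abs_two]
  have h2 := Real.mul_abs_le_abs_sin (x := u / 2) (by rw [abs_div, abs_two]; linarith)
  rw [abs_div, abs_two] at h2
  have hs := abs_sub_le_norm_exp_sub ht hs0 u
  have h3 : ‖(t : ℂ) * (Complex.exp (Complex.I * u) - 1)‖ ≤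
      ‖(t : ℂ) * Complex.exp (Complex.I * u) - s‖ + |s - t| := by
    have : (t : ℂ) * (Complex.exp (Complex.I * u) - 1) =
        ((t : ℂ) * Complex.exp (Complex.I * u) - s) + ((s - t : ℝ) : ℂ) := by push_cast; ring
    rw [this]
    refine (norm_add_le _ _).trans ?_
    rw [Complex.norm_real, Real.norm_eq_abs]
  have h4 : t * |u| / Real.pi * 2 ≤ t * (2 * |Real.sin (u / 2)|) := by
    have := mul_le_mul_of_nonneg_left h2 (by positivity : 0 ≤ 2 * t)
    calc t * |u| / Real.pi * 2 = 2 * t * (2 / Real.pi * (|u| / 2)) := by ring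
      _ ≤ _ := this
      _ = _ := by ring
  linarith

lemma integral_two_div {t δ : ℝ} (ht : 0 < t) (hδ : 0 < δ) :
    ∫ u in (0 : ℝ)..Real.pi, 2 / (δ + t * u / Real.pi) =
      2 * Real.pi / t * Real.log (1 + t / δ) := by
  have hpi := Real.pi_pos
  have hpos : ∀ u ∈ uIcc 0 Real.pi, 0 < δ + t * u / Real.pi := fun u hu => by
    rw [uIcc_of_le hpi.le] at hu
    have := hu.1
    positivity
  rw [intervalIntegral.integral_eq_sub_of_hasDerivAt
    (f := fun u => 2 * Real.pi / t * Real.log (δ + t * u / Real.pi))]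
  · rw [← mul_sub, mul_div_cancel_right₀ _ hpi.ne', mul_zero, zero_div, add_zero,
      ← Real.log_div (by positivity) hδ.ne', add_div, div_self hδ.ne']
  · intro u hu
    have h1 : HasDerivAt (fun u : ℝ => δ + t * u / Real.pi) (t / Real.pi) u := by
      have := (((hasDerivAt_id u).const_mul t).div_const Real.pi).const_add δ
      simpa using this
    refine ((h1.log (hpos u hu).ne').const_mul (2 * Real.pi / t)).congr_deriv ?_
    rw [mul_div_assoc']
    congr 1
    field_simp
  · refine ContinuousOn.intervalIntegrable ?_
    exact ContinuousOn.div (by fun_prop) (by fun_prop) fun u hu => (hpos u hu).ne'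

lemma integral_inv_norm_circleMap_sub_le {t δ : ℝ} (ht : 0 < t) (hδ : 0 < δ) {a : ℂ}
    (ha : δ ≤ |‖a‖ - t|) :
    ∫ θ in (0 : ℝ)..2 * Real.pi, 1 / ‖a - circleMap 0 t θ‖ ≤
      4 * Real.pi / t * Real.log (1 + t / δ) := by
  have hpi := Real.pi_pos
  set s := ‖a‖ with hs
  -- Rotating by arg a puts the point on the nonnegative real axis; periodicity then recentres the
  -- integral to [-π, π].
  set G : ℝ → ℝ := fun u => 1 / ‖(t : ℂ) * Complex.exp (Complex.I * u) - s‖ with hG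
  have hlow := fun u (hu : |u| ≤ Real.pi) => le_norm_exp_sub (u := u) ht (norm_nonneg a) ha hu
  have hper : Function.Periodic G (2 * Real.pi) := fun u => by
    simp only [hG]
    rw [Complex.ofReal_add, mul_add, mul_comm Complex.I ((2 * Real.pi : ℝ) : ℂ)]
    push_cast
    rw [Complex.exp_periodic]
  have hpos : ∀ u : ℝ, 0 < ‖(t : ℂ) * Complex.exp (Complex.I * u) - s‖ := fun u =>
    hδ.trans_le (ha.trans (abs_sub_le_norm_exp_sub ht (norm_nonneg a) u))
  have hcont : Continuous G := by
    refine Continuous.div continuous_const (by fun_prop) fun u => (hpos u).ne'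
  have h1 : ∀ θ, 1 / ‖a - circleMap 0 t θ‖ = G (θ - Complex.arg a) := fun θ => by
    simp only [hG]
    congr 1
    have : a - circleMap 0 t θ = -(Complex.exp (Complex.arg a * Complex.I) *
        ((t : ℂ) * Complex.exp (Complex.I * (θ - Complex.arg a : ℝ)) - s)) := by
      conv_lhs => rw [← Complex.norm_mul_exp_arg_mul_I a]
      rw [circleMap_zero, mul_sub, mul_left_comm, ← Complex.exp_add, ← hs]
      push_cast
      ring_nf
    rw [this, norm_neg, norm_mul, Complex.norm_exp_ofReal_mul_I, one_mul]
  simp only [h1]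
  rw [intervalIntegral.integral_comp_sub_right (fun u => G u)]
  have h2 := hper.intervalIntegral_add_eq (0 - Complex.arg a) (-Real.pi)
  rw [show 2 * Real.pi - Complex.arg a = 0 - Complex.arg a + 2 * Real.pi by ring, h2,
    show -Real.pi + 2 * Real.pi = Real.pi by ring,
    ← intervalIntegral.integral_add_adjacent_intervals (b := 0) (hcont.intervalIntegrable _ _)
      (hcont.intervalIntegrable _ _)]
  have hle : ∀ u, |u| ≤ Real.pi → G u ≤ 2 / (δ + t * |u| / Real.pi) := fun u hu => by
    simp only [hG]
    rw [div_le_div_iff₀ (hpos u) (by positivity)]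
    linarith [hlow u hu]
  have hi : IntervalIntegrable (fun u => 2 / (δ + t * u / Real.pi)) MeasureTheory.volume 0
      Real.pi := by
    refine ContinuousOn.intervalIntegrable
      (ContinuousOn.div (by fun_prop) (by fun_prop) fun u hu => ?_)
    rw [uIcc_of_le hpi.le] at hu
    have := hu.1
    positivity
  have h3 : ∫ u in (0 : ℝ)..Real.pi, G u ≤ 2 * Real.pi / t * Real.log (1 + t / δ) := by
    rw [← integral_two_div ht hδ]
    refine intervalIntegral.integral_mono_on hpi.le (hcont.intervalIntegrable _ _) hi fun u hu => ?_
    have := hle u (by rw [abs_of_nonneg hu.1]; exact hu.2)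
    rwa [abs_of_nonneg hu.1] at this
  have h4 : ∫ u in -Real.pi..(0 : ℝ), G u ≤ 2 * Real.pi / t * Real.log (1 + t / δ) := by
    rw [← integral_two_div ht hδ, ← neg_zero, ← intervalIntegral.integral_comp_neg]
    simp only [neg_zero]
    refine intervalIntegral.integral_mono_on hpi.le ?_ hi fun u hu => ?_
    · exact (hcont.comp continuous_neg).intervalIntegrable _ _
    have := hle (-u) (by rw [abs_neg, abs_of_nonneg hu.1]; exact hu.2)
    rwa [abs_neg, abs_of_nonneg hu.1] at this
  calc _ ≤ _ := add_le_add h4 h3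
    _ = _ := by ring

/-! ### The contour kernel, Taylor sums and the terms of the bracket. -/

lemma pow_div_pow_mul_sub (m : ℕ) {z ζ : ℂ} (hζ : ζ ≠ 0) (hz : ζ ≠ z) :
    z ^ m / (ζ ^ m * (ζ - z)) =
      (ζ - z)⁻¹ - ∑ j ∈ Finset.range m, z ^ j * (1 / ζ ^ (j + 1)) := by
  have h := sub_ne_zero.2 hz
  induction m with
  | zero => simp
  | succ m ih =>
    rw [Finset.sum_range_succ, ← sub_sub, ← ih]
    field_simp
    ring

/-- The kernel is the Cauchy kernel minus the first m terms of its geometric expansion, and those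
terms integrate to the Taylor coefficients at 0. -/
lemma circleIntegral_mul_kernel {H : ℂ → ℂ} {t : ℝ} (ht : 0 < t)
    (hH : DifferentiableOn ℂ H (Metric.closedBall 0 t)) (m : ℕ) {z : ℂ} (hz : ‖z‖ < t) :
    (∮ ζ in C(0, t), H ζ * (z ^ m / (ζ ^ m * (ζ - z)))) =
      2 * Real.pi * Complex.I * (H z - taylorSum H m z) := by
  have hd : DiffContOnCl ℂ H (Metric.ball 0 t) := by
    refine DifferentiableOn.diffContOnCl ?_
    rwa [closure_ball _ ht.ne']
  have hne : ∀ ζ ∈ Metric.sphere (0 : ℂ) t, ζ ≠ 0 ∧ ζ ≠ z := fun ζ hζ => by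
    rw [mem_sphere_zero_iff_norm] at hζ
    constructor
    · rintro rfl; rw [norm_zero] at hζ; exact ht.ne hζ
    · rintro rfl; exact hz.ne hζ
  have hc := hH.continuousOn.mono Metric.sphere_subset_closedBall
  have hi1 : CircleIntegrable (fun ζ => (ζ - z)⁻¹ • H ζ) 0 t :=
    ContinuousOn.circleIntegrable ht.le
      (((continuousOn_id.sub continuousOn_const).inv₀
        fun ζ hζ => sub_ne_zero.2 (hne ζ hζ).2).smul hc)
  have hc2 : ∀ j : ℕ, ContinuousOn (fun ζ : ℂ => 1 / (ζ - 0) ^ (j + 1)) (Metric.sphere 0 t) :=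
    fun j => ContinuousOn.div (by fun_prop) (by fun_prop)
      fun ζ hζ => by simpa using (hne ζ hζ).1
  have hi2 : ∀ j, CircleIntegrable (fun ζ => (1 / (ζ - 0) ^ (j + 1)) • H ζ) 0 t := fun j =>
    ContinuousOn.circleIntegrable ht.le ((hc2 j).smul hc)
  have hi3 : ∀ j ∈ Finset.range m,
      CircleIntegrable (fun ζ => z ^ j • ((1 / (ζ - 0) ^ (j + 1)) • H ζ)) 0 t :=
    fun j _ => (hi2 j).const_smul
  have h1 : (∮ ζ in C(0, t), H ζ * (z ^ m / (ζ ^ m * (ζ - z)))) =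
      ∮ ζ in C(0, t), ((ζ - z)⁻¹ • H ζ -
        ∑ j ∈ Finset.range m, z ^ j • ((1 / (ζ - 0) ^ (j + 1)) • H ζ)) := by
    refine circleIntegral.integral_congr ht.le fun ζ hζ => ?_
    simp only [smul_eq_mul, sub_zero]
    rw [pow_div_pow_mul_sub m (hne ζ hζ).1 (hne ζ hζ).2, mul_sub, Finset.mul_sum, mul_comm]
    congr 1
    exact Finset.sum_congr rfl fun j _ => by ring
  rw [h1, circleIntegral.integral_sub hi1 (CircleIntegrable.fun_sum _ hi3),
    hd.circleIntegral_sub_inv_smul (by simpa using hz), circleIntegral.integral_fun_sum hi3, mul_sub,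
    taylorSum, Finset.mul_sum, smul_eq_mul]
  congr 1
  refine Finset.sum_congr rfl fun j _ => ?_
  rw [circleIntegral.integral_smul, DiffContOnCl.circleIntegral_one_div_sub_center_pow_smul ht j hd]
  simp only [smul_eq_mul]
  ring

/-- All singularities lie inside the circle and the integrand is O(R^(-2)), so the contour can be
pushed to infinity. -/
lemma circleIntegral_inv_mul_kernel {t : ℝ} (ht : 0 < t) (m : ℕ) {a z : ℂ} (ha : ‖a‖ < t)
    (hz : ‖z‖ < t) : (∮ ζ in C(0, t), (ζ - a)⁻¹ * (z ^ m / (ζ ^ m * (ζ - z)))) = 0 := by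
  have hpi := Real.pi_pos
  have hne : ∀ ζ : ℂ, t ≤ ‖ζ‖ → ζ ≠ 0 ∧ ζ - a ≠ 0 ∧ ζ - z ≠ 0 := fun ζ hζ => by
    refine ⟨?_, ?_, ?_⟩
    · rintro rfl; rw [norm_zero] at hζ; linarith
    · rw [sub_ne_zero]; rintro rfl; linarith
    · rw [sub_ne_zero]; rintro rfl; linarith
  have hd : ∀ ζ : ℂ, t ≤ ‖ζ‖ →
      DifferentiableAt ℂ (fun ζ => (ζ - a)⁻¹ * (z ^ m / (ζ ^ m * (ζ - z)))) ζ := fun ζ hζ => by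
    obtain ⟨h1, h2, h3⟩ := hne ζ hζ
    exact DifferentiableAt.mul (DifferentiableAt.inv (by fun_prop) h2)
      (DifferentiableAt.div (by fun_prop) (by fun_prop) (mul_ne_zero (pow_ne_zero _ h1) h3))
  have heq : ∀ R, t ≤ R → (∮ ζ in C(0, R), (ζ - a)⁻¹ * (z ^ m / (ζ ^ m * (ζ - z)))) =
      ∮ ζ in C(0, t), (ζ - a)⁻¹ * (z ^ m / (ζ ^ m * (ζ - z))) := fun R hR =>
    Complex.circleIntegral_eq_of_differentiable_on_annulus_off_countable ht hR countable_empty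
      (fun ζ hζ => (hd ζ (by simpa using hζ.2)).continuousAt.continuousWithinAt)
      (fun ζ hζ => hd ζ (by
        have := hζ.1.2
        simp only [mem_closedBall_zero_iff, not_le] at this
        exact this.le))
  have hbound : ∀ᶠ R in atTop,
      ‖∮ ζ in C(0, t), (ζ - a)⁻¹ * (z ^ m / (ζ ^ m * (ζ - z)))‖ ≤
        8 * Real.pi * ‖z‖ ^ m / R := by
    filter_upwards [eventually_ge_atTop (2 * t), eventually_ge_atTop 1] with R hR hR1
    have hR0 : 0 < R := by linarith
    rw [← heq R (by linarith)]
    refine (circleIntegral.norm_integral_le_of_norm_le_const hR0.le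
      (C := 4 * ‖z‖ ^ m / R ^ 2) fun ζ hζ => ?_).trans (le_of_eq (by field_simp; ring))
    rw [mem_sphere_zero_iff_norm] at hζ
    have h1 : R / 2 ≤ ‖ζ - a‖ := by linarith [norm_sub_norm_le ζ a]
    have h2 : R / 2 ≤ ‖ζ - z‖ := by linarith [norm_sub_norm_le ζ z]
    rw [norm_mul, norm_inv, norm_div, norm_mul, norm_pow, norm_pow, hζ]
    calc ‖ζ - a‖⁻¹ * (‖z‖ ^ m / (R ^ m * ‖ζ - z‖)) ≤
        (R / 2)⁻¹ * (‖z‖ ^ m / (1 * (R / 2))) := by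
          gcongr
          exact one_le_pow₀ hR1
      _ = _ := by field_simp; ring
  have hlim : Tendsto (fun R : ℝ => 8 * Real.pi * ‖z‖ ^ m / R) atTop (𝓝 0) :=
    tendsto_const_nhds.div_atTop tendsto_id
  exact norm_le_zero_iff.1 (ge_of_tendsto hlim hbound)

lemma taylorSum_congr {g₁ g₂ : ℂ → ℂ} (h : g₁ =ᶠ[𝓝 0] g₂) (m : ℕ) (z : ℂ) :
    taylorSum g₁ m z = taylorSum g₂ m z := by
  unfold taylorSum
  exact Finset.sum_congr rfl fun j _ => by rw [h.iteratedDeriv_eq]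

lemma taylorSum_add {g₁ g₂ : ℂ → ℂ} (h₁ : AnalyticAt ℂ g₁ 0) (h₂ : AnalyticAt ℂ g₂ 0) (m : ℕ)
    (z : ℂ) : taylorSum (fun w => g₁ w + g₂ w) m z = taylorSum g₁ m z + taylorSum g₂ m z := by
  unfold taylorSum
  rw [← Finset.sum_add_distrib]
  refine Finset.sum_congr rfl fun j _ => ?_
  rw [iteratedDeriv_fun_add h₁.contDiffAt h₂.contDiffAt]
  ring

/-- A summand of the bracket is thus a principal part made to vanish to order m at 0. -/
lemma taylorSum_inv_sub {a z : ℂ} (n : ℂ) (ha : a ≠ 0) (hz : z ≠ a) (m : ℕ) :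
    n / (z - a) - taylorSum (fun w => n / (w - a)) m z = n * (z ^ m / ((z - a) * a ^ m)) := by
  have h1 : ∀ j, iteratedDeriv j (fun w : ℂ => n / (w - a)) 0 =
      n * ((-1) ^ j * j.factorial * (-a) ^ (-1 - j : ℤ)) := fun j => by
    have h2 : (fun w : ℂ => n / (w - a)) = fun w => n * (1 * w - a)⁻¹ := by
      ext w; rw [one_mul, div_eq_mul_inv]
    rw [h2, iteratedDeriv_const_mul_field, iteratedDeriv_eq_iterate, iter_deriv_inv_linear_sub]
    simp
  have h2 : taylorSum (fun w => n / (w - a)) m z =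
      -(n * ∑ j ∈ Finset.range m, z ^ j * (1 / a ^ (j + 1))) := by
    rw [taylorSum, Finset.mul_sum, ← Finset.sum_neg_distrib]
    refine Finset.sum_congr rfl fun j _ => ?_
    have hj : (j.factorial : ℂ) ≠ 0 := by exact_mod_cast j.factorial_ne_zero
    have h3 : (-a) ^ (-1 - j : ℤ) = ((-1) ^ (j + 1) * a ^ (j + 1))⁻¹ := by
      rw [← mul_pow, neg_one_mul, ← zpow_natCast, ← zpow_neg]
      congr 1
      push_cast
      ring
    rw [h1, h3]
    have h4 : ((-1 : ℂ) ^ j) * (-1) ^ j = 1 := by rw [← mul_pow]; simp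
    have h5 : ((-1 : ℂ) ^ j) ≠ 0 := pow_ne_zero _ (by norm_num)
    rw [pow_succ (-1 : ℂ)]
    field_simp
  have h3 := pow_div_pow_mul_sub m ha hz.symm
  have h4 : z ^ m / ((z - a) * a ^ m) = -(z ^ m / (a ^ m * (a - z))) := by
    rw [← neg_sub a z, neg_mul, div_neg, mul_comm (a - z)]
  rw [h2, h4, h3, ← neg_sub a z, div_neg]
  ring

lemma taylorSum_sum {Z : Finset ℂ} {G : ℂ → ℂ → ℂ} (h : ∀ a ∈ Z, AnalyticAt ℂ (G a) 0) (m : ℕ)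
    (z : ℂ) : taylorSum (fun w => ∑ a ∈ Z, G a w) m z = ∑ a ∈ Z, taylorSum (G a) m z := by
  classical
  induction Z using Finset.induction_on with
  | empty =>
    simp [taylorSum]
  | insert a s ha ih =>
    simp only [Finset.sum_insert ha]
    rw [taylorSum_add (h a (Finset.mem_insert_self _ _))
      (Finset.analyticAt_fun_sum s fun b hb => h b (Finset.mem_insert_of_mem hb)),
      ih fun b hb => h b (Finset.mem_insert_of_mem hb)]

lemma bracket_eq_sum {f : ℂ → ℂ} {Z : Finset ℂ} {r : ℝ} (hZ : ∀ a, ‖a‖ < r → ord f a ≠ 0 → a ∈ Z)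
    (hZ' : ∀ a ∈ Z, ‖a‖ < r) (m : ℕ) (z : ℂ) :
    bracket f m r z = ∑ a ∈ Z, (ord f a : ℂ) * (z ^ m / ((z - a) * a ^ m)) := by
  have key : ∀ c : ℂ → ℕ, (∀ a, ord f a = 0 → c a = 0) →
      ∑ᶠ (q : ℂ) (_ : ‖q‖ < r), (c q : ℂ) * (z ^ m / ((z - q) * q ^ m)) =
        ∑ a ∈ Z, (c a : ℂ) * (z ^ m / ((z - a) * a ^ m)) := fun c hc => by
    rw [finsum_eq_sum_of_support_subset (s := Z)]
    · exact Finset.sum_congr rfl fun a ha => by simp [hZ' a ha]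
    · intro a ha
      rw [Function.mem_support] at ha
      by_cases har : ‖a‖ < r
      · refine hZ a har fun h0 => ha ?_
        simp [hc a h0]
      · simp [har] at ha
  rw [bracket, key _ (fun a h => by rw [ord] at h; simp [zeroMult, h]),
    key _ (fun a h => by rw [ord] at h; simp [poleMult, h]), ← Finset.sum_sub_distrib]
  refine Finset.sum_congr rfl fun a _ => ?_
  rw [← sub_mul]
  congr 1
  change (((ord f a).toNat : ℕ) : ℂ) - ((-ord f a).toNat : ℕ) = _
  have := Int.toNat_sub_toNat_neg (ord f a)
  exact_mod_cast congrArg (Int.cast (R := ℂ)) this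

/-! ### The remainder as a contour integral, and its size. -/

/-- The remainder in the partial fraction expansion as a contour integral. -/
lemma remainder_eq_circleIntegral {f : ℂ → ℂ} (hf : MeromorphicNFOn f univ)
    (hord : ∀ a, meromorphicOrderAt f a ≠ ⊤) (h0 : ord f 0 = 0) {t δ : ℝ} (ht : 0 < t)
    (hδ : 0 < δ) (hgap : ∀ a, ord f a ≠ 0 → δ ≤ |‖a‖ - t|) (m : ℕ) {z : ℂ} (hz : ‖z‖ < t)
    (hz0 : ord f z = 0) :
    logDeriv f z - (taylorSum (logDeriv f) m z + bracket f m t z) =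
      (2 * Real.pi * Complex.I)⁻¹ *
        ∮ ζ in C(0, t), logDeriv f ζ * (z ^ m / (ζ ^ m * (ζ - z))) := by
  -- The radius exceeds t, so that the factorisation holds near the closed disc, but by less than
  -- the gap, so that every point of `Z` still lies in |a| < t.
  obtain ⟨Z, g, hZ, hg, hg0, hfac⟩ := exists_factorization hf hord 0 (t + δ / 2)
  have hZt : ∀ a ∈ Z, ‖a‖ < t := fun a ha => by
    obtain ⟨h1, h2⟩ := (hZ a).1 ha
    rw [mem_closedBall_zero_iff] at h1
    by_contra! h3
    have := hgap a h2
    rw [abs_of_nonneg (by linarith)] at this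
    linarith
  have hsub : Metric.closedBall (0 : ℂ) t ⊆ Metric.ball 0 (t + δ / 2) :=
    Metric.closedBall_subset_ball (by linarith)
  have hH : ∀ w ∈ Metric.ball (0 : ℂ) (t + δ / 2), AnalyticAt ℂ (logDeriv g) w := fun w hw =>
    ((hg w (Metric.ball_subset_closedBall hw)).deriv).div (hg w (Metric.ball_subset_closedBall hw))
      (hg0 w (Metric.ball_subset_closedBall hw))
  have hlog : ∀ w ∈ Metric.ball (0 : ℂ) (t + δ / 2), ord f w = 0 →
      logDeriv f w = ∑ a ∈ Z, (ord f a : ℂ) / (w - a) + logDeriv g w := fun w hw hw0 => by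
    rw [(logDeriv_congr_nhds (hfac w hw)).eq_of_nhds]
    refine logDeriv_prod_mul (fun a ha => ?_)
      (hg w (Metric.ball_subset_closedBall hw)).differentiableAt
      (hg0 w (Metric.ball_subset_closedBall hw))
    rintro rfl
    exact ((hZ _).1 ha).2 hw0
  have h00 : (0 : ℂ) ∈ Metric.ball (0 : ℂ) (t + δ / 2) := by
    exact Metric.mem_ball_self (by positivity)
  have hZ0 : ∀ a ∈ Z, a ≠ 0 := by
    rintro a ha rfl
    exact ((hZ _).1 ha).2 h0
  have hnear : logDeriv f =ᶠ[𝓝 0] fun w => ∑ a ∈ Z, (ord f a : ℂ) / (w - a) + logDeriv g w := by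
    have h1 : ∀ᶠ w in 𝓝 (0 : ℂ), f w ≠ 0 :=
      ((hf (mem_univ 0)).meromorphicOrderAt_nonneg_iff_analyticAt.1
        (by rw [← coe_ord hord, h0]; rfl)).continuousAt.eventually_ne
        (ne_zero_of_ord_eq_zero hf hord h0)
    filter_upwards [h1, Metric.isOpen_ball.mem_nhds h00] with w hw hwb
    exact hlog w hwb (ord_eq_zero_of_ne_zero hf hw)
  have hzb : z ∈ Metric.ball (0 : ℂ) (t + δ / 2) := hsub (by simpa using hz.le)
  have han : ∀ a ∈ Z, AnalyticAt ℂ (fun w : ℂ => (ord f a : ℂ) / (w - a)) 0 := fun a ha =>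
    analyticAt_const.div (by fun_prop) (by simpa using hZ0 a ha)
  rw [taylorSum_congr hnear, taylorSum_add (Finset.analyticAt_fun_sum Z han) (hH 0 h00),
    taylorSum_sum han, hlog z hzb hz0,
    bracket_eq_sum (Z := Z) (fun a ha ha0 => (hZ a).2 ⟨by
      rw [mem_closedBall_zero_iff]; linarith, ha0⟩) hZt]
  have hsum : ∑ a ∈ Z, (ord f a : ℂ) * (z ^ m / ((z - a) * a ^ m)) =
      ∑ a ∈ Z, (ord f a : ℂ) / (z - a) -
        ∑ a ∈ Z, taylorSum (fun w => (ord f a : ℂ) / (w - a)) m z := by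
    rw [← Finset.sum_sub_distrib]
    refine Finset.sum_congr rfl fun a ha => ?_
    rw [taylorSum_inv_sub _ (hZ0 a ha) (by rintro rfl; exact ((hZ _).1 ha).2 hz0)]
  have hsph : ∀ ζ ∈ Metric.sphere (0 : ℂ) t, ζ ≠ 0 ∧ ζ - z ≠ 0 ∧ (∀ a ∈ Z, ζ - a ≠ 0) ∧
      ord f ζ = 0 := fun ζ hζ => by
    rw [mem_sphere_zero_iff_norm] at hζ
    refine ⟨?_, ?_, fun a ha => ?_, ?_⟩
    · rintro rfl; rw [norm_zero] at hζ; exact ht.ne hζ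
    · rw [sub_ne_zero]; rintro rfl; exact hz.ne hζ
    · rw [sub_ne_zero]; rintro rfl; exact (hZt _ ha).ne hζ
    · by_contra h
      have := hgap ζ h
      rw [hζ, sub_self, abs_zero] at this
      linarith
  have hHc : DifferentiableOn ℂ (logDeriv g) (Metric.closedBall 0 t) := fun w hw =>
    (hH w (hsub hw)).differentiableAt.differentiableWithinAt
  have hK : ContinuousOn (fun ζ => z ^ m / (ζ ^ m * (ζ - z))) (Metric.sphere (0 : ℂ) t) :=
    continuousOn_const.div (by fun_prop) fun ζ hζ =>
      mul_ne_zero (pow_ne_zero _ (hsph ζ hζ).1) (hsph ζ hζ).2.1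
  have hi1 : ∀ a ∈ Z, CircleIntegrable (fun ζ => (ord f a : ℂ) *
      ((ζ - a)⁻¹ * (z ^ m / (ζ ^ m * (ζ - z))))) 0 t := fun a ha =>
    ContinuousOn.circleIntegrable ht.le (continuousOn_const.mul
      ((ContinuousOn.inv₀ (by fun_prop) fun ζ hζ => (hsph ζ hζ).2.2.1 a ha).mul hK))
  have hi2 : CircleIntegrable (fun ζ => logDeriv g ζ * (z ^ m / (ζ ^ m * (ζ - z)))) 0 t :=
    ContinuousOn.circleIntegrable ht.le
      ((hHc.continuousOn.mono Metric.sphere_subset_closedBall).mul hK)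
  have hint : (∮ ζ in C(0, t), logDeriv f ζ * (z ^ m / (ζ ^ m * (ζ - z)))) =
      2 * Real.pi * Complex.I * (logDeriv g z - taylorSum (logDeriv g) m z) := by
    rw [← circleIntegral_mul_kernel ht hHc m hz]
    have : (∮ ζ in C(0, t), logDeriv f ζ * (z ^ m / (ζ ^ m * (ζ - z)))) =
        ∮ ζ in C(0, t), (∑ a ∈ Z, (ord f a : ℂ) * ((ζ - a)⁻¹ * (z ^ m / (ζ ^ m * (ζ - z)))) +
          logDeriv g ζ * (z ^ m / (ζ ^ m * (ζ - z)))) := by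
      refine circleIntegral.integral_congr ht.le fun ζ hζ => ?_
      rw [hlog ζ (hsub (Metric.sphere_subset_closedBall hζ)) (hsph ζ hζ).2.2.2, add_mul,
        Finset.sum_mul]
      congr 1
      exact Finset.sum_congr rfl fun a _ => by rw [div_eq_mul_inv, mul_assoc]
    rw [this, circleIntegral.integral_add (CircleIntegrable.fun_sum _ hi1) hi2,
      circleIntegral.integral_fun_sum hi1, Finset.sum_eq_zero, zero_add]
    intro a ha
    rw [circleIntegral.integral_const_mul, circleIntegral_inv_mul_kernel ht m (hZt a ha) hz,
      mul_zero]
  rw [hint, hsum, inv_mul_cancel_left₀ Complex.two_pi_I_ne_zero]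
  ring

/-- The integral of the logarithmic derivative over a circle that stays away from all zeros and
poles grows at most like `t ^ (1 + β) * log t`. -/
lemma norm_circleIntegral_logDeriv_mul_le {f : ℂ → ℂ} (hf : MeromorphicNFOn f univ)
    (hord : ∀ a, meromorphicOrderAt f a ≠ ⊤) {β : ℝ} (hβ : -1 < β) {N : ℕ} (hN : 0 < N)
    (H : ∀ h : ℂ, (N : ℝ) ≤ ‖h‖ → ScaleControl f β N h) {t δ : ℝ} (ht : (N : ℝ) ≤ t)
    (hδ : 0 < δ) (hgap : ∀ a, ord f a ≠ 0 → δ ≤ |‖a‖ - t|) {k : ℂ → ℂ} {M : ℝ} (hM0 : 0 ≤ M)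
    (hk : ∀ ζ ∈ Metric.sphere (0 : ℂ) t, ‖k ζ‖ ≤ M) :
    ‖∮ ζ in C(0, t), logDeriv f ζ * k ζ‖ ≤ t * M * (2 * Real.pi * ((N : ℝ) ^ 2 * t ^ β) +
      ((4 * Real.pi * N + 2) * N * t ^ (1 + β)) *
        (4 * Real.pi / t * Real.log (1 + t / δ))) := by
  classical
  have hpi := Real.pi_pos
  have hN0 : (0 : ℝ) < N := by exact_mod_cast hN
  have ht0 : 0 < t := hN0.trans_le ht
  obtain ⟨Z, -, hZ, -⟩ := exists_factorization hf hord 0 (t + t ^ (-β) / (2 * N))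
  -- The local bounds use a set of zeros and poles depending on the point of the circle. All these
  -- sets lie in this fixed one, so sum and integral can be exchanged.
  set A := Z.filter (fun a => |‖a‖ - t| ≤ t ^ (-β) / (2 * N)) with hA
  have hA0 : ∀ a ∈ A, ord f a ≠ 0 := fun a ha => ((hZ a).1 (Finset.mem_filter.1 ha).1).2
  have hsum : ∑ a ∈ A, |(ord f a : ℝ)| ≤ (4 * Real.pi * N + 2) * N * t ^ (1 + β) :=
    sum_ord_annulus_le hβ hN H ht fun a ha => (Finset.mem_filter.1 ha).2
  have hcirc : ∀ θ, ‖circleMap 0 t θ‖ = t := fun θ => by rw [norm_circleMap_zero, abs_of_pos ht0]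
  have hpt : ∀ θ, ‖logDeriv f (circleMap 0 t θ)‖ ≤
      (N : ℝ) ^ 2 * t ^ β + ∑ a ∈ A, |(ord f a : ℝ)| * (1 / ‖a - circleMap 0 t θ‖) := fun θ => by
    have hord0 : ord f (circleMap 0 t θ) = 0 := by
      by_contra h
      have := hgap _ h
      rw [hcirc, sub_self, abs_zero] at this
      linarith
    obtain ⟨A', hA', hle⟩ := (H (circleMap 0 t θ) (by rwa [hcirc])).2 hord0
    rw [hcirc] at hA' hle
    refine hle.trans (add_le_add le_rfl ?_)
    simp only [mul_one_div]
    refine Finset.sum_le_sum_of_subset_of_nonneg (fun a ha => ?_) fun _ _ _ => by positivity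
    have h1 : |‖a‖ - t| ≤ t ^ (-β) / (2 * N) := by
      have := abs_norm_sub_norm_le a (circleMap 0 t θ)
      rw [hcirc] at this
      exact this.trans (hA' a ha).1.le
    refine Finset.mem_filter.2 ⟨(hZ a).2 ⟨?_, (hA' a ha).2⟩, h1⟩
    rw [mem_closedBall_zero_iff]
    linarith [le_abs_self (‖a‖ - t)]
  have hcont : ∀ a ∈ A, Continuous fun θ => |(ord f a : ℝ)| * (1 / ‖a - circleMap 0 t θ‖) :=
    fun a ha => by
      refine continuous_const.mul (continuous_const.div
        (continuous_const.sub (continuous_circleMap 0 t)).norm fun θ h => ?_)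
      have := hgap a (hA0 a ha)
      rw [sub_eq_zero.1 (norm_eq_zero.1 h), hcirc, sub_self, abs_zero] at this
      linarith
  have hcontS := continuous_finsetSum A hcont
  have hlogn : 0 ≤ Real.log (1 + t / δ) := Real.log_nonneg (by
    have : 0 ≤ t / δ := by positivity
    linarith)
  calc ‖∮ ζ in C(0, t), logDeriv f ζ * k ζ‖ ≤ ∫ θ in (0 : ℝ)..2 * Real.pi, t * M *
        ((N : ℝ) ^ 2 * t ^ β + ∑ a ∈ A, |(ord f a : ℝ)| * (1 / ‖a - circleMap 0 t θ‖)) := by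
        rw [circleIntegral]
        refine intervalIntegral.norm_integral_le_of_norm_le (by positivity)
          (Eventually.of_forall fun θ _ => ?_)
          ((continuous_const.mul (continuous_const.add hcontS)).intervalIntegrable _ _)
        rw [deriv_circleMap, smul_eq_mul, norm_mul, norm_mul, norm_mul, hcirc, Complex.norm_I,
          mul_one, mul_assoc, mul_comm M]
        refine mul_le_mul_of_nonneg_left ?_ ht0.le
        exact mul_le_mul (hpt θ) (hk _ (circleMap_mem_sphere _ ht0.le _)) (norm_nonneg _)
          ((norm_nonneg _).trans (hpt θ))
    _ = t * M * (2 * Real.pi * ((N : ℝ) ^ 2 * t ^ β) + ∑ a ∈ A, |(ord f a : ℝ)| *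
          ∫ θ in (0 : ℝ)..2 * Real.pi, 1 / ‖a - circleMap 0 t θ‖) := by
        rw [intervalIntegral.integral_const_mul, intervalIntegral.integral_add
          (continuous_const.intervalIntegrable _ _) (hcontS.intervalIntegrable _ _),
          intervalIntegral.integral_finsetSum
            fun a ha => (hcont a ha).intervalIntegrable _ _]
        simp only [intervalIntegral.integral_const_mul, intervalIntegral.integral_const, smul_eq_mul,
          sub_zero]
        ring
    _ ≤ t * M * (2 * Real.pi * ((N : ℝ) ^ 2 * t ^ β) + ∑ a ∈ A, |(ord f a : ℝ)| *
          (4 * Real.pi / t * Real.log (1 + t / δ))) := by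
        gcongr with a ha
        exact integral_inv_norm_circleMap_sub_le ht0 hδ (hgap a (hA0 a ha))
    _ ≤ _ := by
        rw [← Finset.sum_mul]
        gcongr

/-- Enlarging the summation radius slightly changes the sum over zeros and poles very little. -/
lemma norm_bracket_sub_bracket_le {f : ℂ → ℂ} (hf : MeromorphicNFOn f univ)
    (hord : ∀ a, meromorphicOrderAt f a ≠ ⊤) {r t R M : ℝ} (hr : 0 < r) (hrt : r ≤ t)
    (hR : 0 ≤ R) (hRr : 2 * R ≤ r)
    (hM : ∀ A : Finset ℂ, (∀ a ∈ A, r ≤ ‖a‖ ∧ ‖a‖ ≤ t) → ∑ a ∈ A, |(ord f a : ℝ)| ≤ M) (m : ℕ)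
    {z : ℂ} (hz : ‖z‖ ≤ R) :
    ‖bracket f m t z - bracket f m r z‖ ≤ M * (2 * R ^ m / r ^ (m + 1)) := by
  classical
  obtain ⟨Z, -, hZ, -⟩ := exists_factorization hf hord 0 t
  set Z' := Z.filter (‖·‖ < t) with hZ'
  have h1 : bracket f m t z = ∑ a ∈ Z', (ord f a : ℂ) * (z ^ m / ((z - a) * a ^ m)) :=
    bracket_eq_sum (fun a ha ha0 => Finset.mem_filter.2
      ⟨(hZ a).2 ⟨mem_closedBall_zero_iff.2 ha.le, ha0⟩, ha⟩)
      (fun a ha => (Finset.mem_filter.1 ha).2) m z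
  have h2 : bracket f m r z =
      ∑ a ∈ Z'.filter (‖·‖ < r), (ord f a : ℂ) * (z ^ m / ((z - a) * a ^ m)) :=
    bracket_eq_sum (fun a ha ha0 => Finset.mem_filter.2 ⟨Finset.mem_filter.2
      ⟨(hZ a).2 ⟨mem_closedBall_zero_iff.2 (ha.trans_le hrt).le, ha0⟩, ha.trans_le hrt⟩, ha⟩)
      (fun a ha => (Finset.mem_filter.1 ha).2) m z
  rw [h1, h2, ← Finset.sum_filter_add_sum_filter_not Z' (‖·‖ < r), add_sub_cancel_left]
  have hmem : ∀ a ∈ Z'.filter (¬ ‖·‖ < r), r ≤ ‖a‖ ∧ ‖a‖ ≤ t := fun a ha => by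
    obtain ⟨h3, h4⟩ := Finset.mem_filter.1 ha
    exact ⟨not_lt.1 h4, (Finset.mem_filter.1 h3).2.le⟩
  calc _ ≤ ∑ a ∈ Z'.filter (¬ ‖·‖ < r), |(ord f a : ℝ)| * (2 * R ^ m / r ^ (m + 1)) := by
        refine (norm_sum_le _ _).trans (Finset.sum_le_sum fun a ha => ?_)
        rw [norm_mul, Complex.norm_intCast]
        refine mul_le_mul_of_nonneg_left ?_ (abs_nonneg _)
        have h3 := (hmem a ha).1
        have h4 : r / 2 ≤ ‖z - a‖ := by
          rw [norm_sub_rev]; linarith [norm_sub_norm_le a z]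
        rw [norm_div, norm_mul, norm_pow, norm_pow]
        calc ‖z‖ ^ m / (‖z - a‖ * ‖a‖ ^ m) ≤ R ^ m / (r / 2 * r ^ m) := by gcongr
          _ = _ := by field_simp; ring
    _ ≤ _ := by
        rw [← Finset.sum_mul]
        gcongr
        exact hM _ hmem

/-! ### Conclusion: the remainder is O(r^(β-m) log r). -/

lemma GeneralisedYosida.exists_remainder_bound {α β : ℝ} (hβ : -1 < β) {f : ℂ → ℂ}
    (hf : GeneralisedYosida α β f) (h0 : ord f 0 = 0) {m : ℕ} (hm : β < m) {R : ℝ} (hR : 0 ≤ R) :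
    ∃ C₁ C₂ : ℝ, ∀ᶠ r : ℝ in atTop, ∀ z, ‖z‖ ≤ R → ord f z = 0 →
      ‖logDeriv f z - (taylorSum (logDeriv f) m z + bracket f m r z)‖ ≤
        (C₁ + C₂ * Real.log r) * r ^ (β - m) := by
  have hpi := Real.pi_pos
  obtain ⟨N, hN, H⟩ := hf.exists_scaleControl
  have hN0 : (0 : ℝ) < N := by exact_mod_cast hN
  have hN1 : (1 : ℝ) ≤ N := by exact_mod_cast hN
  set K : ℝ := (4 * Real.pi * N + 2) * N with hK
  have hK0 : 0 < K := by positivity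
  -- With x = r^(1+β) ≥ 1 and t ≤ r + w = (2Nx + 1)w, this constant gives 1 + t/δ ≤ C x², so the
  -- logarithm costs only O(log r).
  set C : ℝ := 1 + (2 * N + 1) * (2 * (K + 2)) with hC
  have hC0 : 0 < C := by positivity
  refine ⟨2 * R ^ m * (N ^ 2 + 2 * K * Real.log C) + 2 * R ^ m * K,
    2 * R ^ m * (2 * K * (2 * (1 + β))), ?_⟩
  filter_upwards [eventually_ge_atTop (N : ℝ), eventually_ge_atTop (2 * R)] with r hrN hrR z hzR hz0
  have hr1 : 1 ≤ r := hN1.trans hrN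
  have hr0 : 0 < r := by linarith
  set x := r ^ (1 + β) with hx
  have hx1 : 1 ≤ x := Real.one_le_rpow hr1 (by linarith)
  set w := r ^ (-β) / (2 * N) with hw
  have hw0 : 0 < w := by positivity
  have hwx : r = 2 * N * x * w := by
    rw [hw, hx]
    have : r ^ (1 + β) * r ^ (-β) = r := by rw [← Real.rpow_add hr0]; simp
    field_simp
    linarith
  have hcount : ∀ A : Finset ℂ, (∀ a ∈ A, r ≤ ‖a‖ ∧ ‖a‖ ≤ r + w) →
      ∑ a ∈ A, |(ord f a : ℝ)| ≤ K * x := fun A hA =>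
    sum_ord_annulus_le hβ hN H hrN fun a ha => by
      rw [abs_of_nonneg (by linarith [(hA a ha).1])]
      linarith [(hA a ha).2]
  obtain ⟨t, hrt, htw, hgap⟩ := exists_good_radius hf.meromorphic hf.order_ne_top hw0 hcount
  set δ := w / (2 * (K * x + 2)) with hδ
  have hδ0 : 0 < δ := by positivity
  have ht0 : 0 < t := hr0.trans_le hrt
  have hzt : ‖z‖ ≤ t / 2 := by linarith
  have hlog : Real.log (1 + t / δ) ≤ Real.log C + 2 * (1 + β) * Real.log r := by
    have h1 : 1 + t / δ ≤ C * x ^ 2 := by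
      have h2 : t / δ ≤ (2 * N * x + 1) * (2 * (K * x + 2)) := by
        rw [div_le_iff₀ hδ0, hδ]
        have : (2 * N * x + 1) * (2 * (K * x + 2)) * (w / (2 * (K * x + 2))) =
            2 * N * x * w + w := by field_simp
        rw [this]
        linarith
      have h3 : (2 * N * x + 1) * (2 * (K * x + 2)) ≤ ((2 * N + 1) * x) * (2 * (K + 2) * x) := by
        refine mul_le_mul ?_ ?_ (by positivity) (by positivity) <;> nlinarith
      have h4 : 1 ≤ x ^ 2 := one_le_pow₀ hx1
      rw [hC]
      nlinarith
    calc Real.log (1 + t / δ) ≤ Real.log (C * x ^ 2) := Real.log_le_log (by positivity) h1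
      _ = _ := by
        rw [Real.log_mul hC0.ne' (by positivity), Real.log_pow, hx, Real.log_rpow hr0]
        push_cast
        ring
  have hlog0 : 0 ≤ Real.log (1 + t / δ) := Real.log_nonneg (by
    have : 0 ≤ t / δ := by positivity
    linarith)
  have hker : ∀ ζ ∈ Metric.sphere (0 : ℂ) t,
      ‖z ^ m / (ζ ^ m * (ζ - z))‖ ≤ 2 * R ^ m / t ^ (m + 1) := fun ζ hζ => by
    rw [mem_sphere_zero_iff_norm] at hζ
    have h2 : t / 2 ≤ ‖ζ - z‖ := by linarith [norm_sub_norm_le ζ z]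
    rw [norm_div, norm_mul, norm_pow, norm_pow, hζ]
    calc ‖z‖ ^ m / (t ^ m * ‖ζ - z‖) ≤ R ^ m / (t ^ m * (t / 2)) := by gcongr
      _ = _ := by field_simp; ring
  have hrem := remainder_eq_circleIntegral hf.meromorphic hf.order_ne_top h0 ht0 hδ0 hgap m
    (z := z) (by linarith) hz0
  have hint := norm_circleIntegral_logDeriv_mul_le hf.meromorphic hf.order_ne_top hβ hN H
    (hrN.trans hrt) hδ0 hgap (by positivity) hker
  have htpow : t ^ (1 + β) = t * t ^ β := by rw [Real.rpow_add ht0, Real.rpow_one]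
  have htpow' : t ^ (β - m) = t ^ β / t ^ m := by rw [Real.rpow_sub ht0, Real.rpow_natCast]
  -- The exponent is negative because β < m, so replacing t by the smaller r only weakens the bound.
  have hmono : t ^ (β - m) ≤ r ^ (β - m) :=
    Real.rpow_le_rpow_of_nonpos hr0 hrt (by linarith)
  have hB₁ : ‖logDeriv f z - (taylorSum (logDeriv f) m z + bracket f m t z)‖ ≤
      2 * R ^ m * (N ^ 2 + 2 * K * Real.log (1 + t / δ)) * r ^ (β - m) := by
    rw [hrem, norm_mul, norm_inv, norm_mul, norm_mul, Complex.norm_I, Complex.norm_real,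
      Real.norm_eq_abs, abs_of_pos hpi, Complex.norm_ofNat, mul_one]
    calc _ ≤ (2 * Real.pi)⁻¹ * _ := mul_le_mul_of_nonneg_left hint (by positivity)
      _ = 2 * R ^ m * (N ^ 2 + 2 * K * Real.log (1 + t / δ)) * t ^ (β - m) := by
        rw [htpow, htpow', hK]
        field_simp
        ring
      _ ≤ _ := by gcongr
  have hB₂ := norm_bracket_sub_bracket_le hf.meromorphic hf.order_ne_top hr0 hrt hR hrR
    (M := K * x) (fun A hA => hcount A fun a ha => ⟨(hA a ha).1, (hA a ha).2.trans htw⟩) m hzR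
  have hB₃ : K * x * (2 * R ^ m / r ^ (m + 1)) = 2 * R ^ m * K * r ^ (β - m) := by
    rw [hx, Real.rpow_add hr0, Real.rpow_one, Real.rpow_sub hr0, Real.rpow_natCast]
    field_simp
    ring
  rw [hB₃] at hB₂
  have hsplit : logDeriv f z - (taylorSum (logDeriv f) m z + bracket f m r z) =
      (logDeriv f z - (taylorSum (logDeriv f) m z + bracket f m t z)) +
        (bracket f m t z - bracket f m r z) := by ring
  rw [hsplit]
  refine (norm_add_le _ _).trans ((add_le_add hB₁ hB₂).trans ?_)
  rw [← add_mul]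
  refine mul_le_mul_of_nonneg_right ?_ (by positivity)
  have h5 : 2 * R ^ m * (2 * K) * Real.log (1 + t / δ) ≤
      2 * R ^ m * (2 * K) * (Real.log C + 2 * (1 + β) * Real.log r) := by gcongr
  linarith

lemma tendsto_add_mul_log_mul_rpow {γ : ℝ} (hγ : γ < 0) (C₁ C₂ : ℝ) :
    Tendsto (fun r : ℝ => (C₁ + C₂ * Real.log r) * r ^ γ) atTop (𝓝 0) := by
  have h1 : Tendsto (fun r : ℝ => r ^ γ) atTop (𝓝 0) := by
    simpa using tendsto_rpow_neg_atTop (neg_pos.2 hγ)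
  have h2 : Tendsto (fun r : ℝ => Real.log r * r ^ γ) atTop (𝓝 0) := by
    have := (isLittleO_log_rpow_atTop (neg_pos.2 hγ)).tendsto_div_nhds_zero
    refine this.congr' ?_
    filter_upwards [eventually_gt_atTop 0] with r hr
    rw [Real.rpow_neg hr.le, div_inv_eq_mul]
  have := (h1.const_mul C₁).add (h2.const_mul C₂)
  simp only [mul_zero, add_zero] at this
  exact this.congr fun r => by ring

lemma ord_eq_zero_of_value {f : ℂ → ℂ} (hf : MeromorphicNFOn f univ) {z : ℂ}
    (h0 : value f z ≠ ((0 : ℂ) : OnePoint ℂ)) (hinf : value f z ≠ OnePoint.infty) :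
    ord f z = 0 := by
  refine ord_eq_zero_of_ne_zero hf fun h => ?_
  unfold value at h0 hinf
  split_ifs at h0 hinf with h1
  · exact hinf rfl
  · exact h0 (by rw [h])

end

end Yosida


theorem theorem16 (α β : ℝ) (hβ : -1 < β) (f : ℂ → ℂ) (hf : Yosida.GeneralisedYosida α β f)
    (h0 : Yosida.value f 0 ≠ ((0 : ℂ) : OnePoint ℂ)) (hinf : Yosida.value f 0 ≠ OnePoint.infty)
    (m : ℕ) (hm : β < (m : ℝ)) :
    TendstoLocallyUniformlyOn
      (fun (r : ℝ) (z : ℂ) =>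
        Yosida.taylorSum (fun w => deriv f w / f w) m z + Yosida.bracket f m r z)
      (fun z => deriv f z / f z) atTop
      {z : ℂ | Yosida.value f z ≠ ((0 : ℂ) : OnePoint ℂ) ∧ Yosida.value f z ≠ OnePoint.infty} := by
  rw [Metric.tendstoLocallyUniformlyOn_iff]
  intro ε hε x _
  obtain ⟨C₁, C₂, hbound⟩ := hf.exists_remainder_bound hβ
    (Yosida.ord_eq_zero_of_value hf.meromorphic h0 hinf) hm (R := ‖x‖ + 1) (by positivity)
  -- The remainder bound depends only on |z| ≤ R, not on the distance to zeros and poles, so any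
  -- bounded neighbourhood will do.
  refine ⟨Metric.ball 0 (‖x‖ + 1) ∩ {z : ℂ | Yosida.value f z ≠ ((0 : ℂ) : OnePoint ℂ) ∧
    Yosida.value f z ≠ OnePoint.infty}, ?_, ?_⟩
  · rw [inter_comm]
    exact inter_mem_nhdsWithin _ (Metric.isOpen_ball.mem_nhds (by simp))
  · filter_upwards [hbound, (Yosida.tendsto_add_mul_log_mul_rpow
      (sub_neg.2 hm) C₁ C₂).eventually (gt_mem_nhds hε)] with r hr hrε z hz
    rw [dist_eq_norm]
    exact (hr z (mem_ball_zero_iff.1 hz.1).le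
      (Yosida.ord_eq_zero_of_value hf.meromorphic hz.2.1 hz.2.2)).trans_lt hrε
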